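/- For $u=u(t,x)$ on $\mathbb R\times\mathbb R$ let $\hat u(\tau,\xi)=\iint e^{-i(x\xi+t\tau)}u(t,x)\,dt\,dx$, and let $X^{s,b}$ be the closure of the Schwartz functions on $\mathbb R^2$ in the norm $$\|u\|_{X^{s,b}}=\Big(\iint|\hat u(\tau,\xi)|^2(1+|\xi|)^{2s}(1+|\tau-\xi^3|)^{2b}\,d\xi\,d\tau\Big)^{1/2};$$ its elements are identified with their Fourier transforms, measurable functions with finite weighted $L^2$ norm. Let $-\frac34<s<0$, $A>0$ and $\varepsilon_1,\varepsilon_2,\varepsilon_3>0$. There is a constant $C$ depending only on $s,A,\varepsilon_1,\varepsilon_2,\varepsilon_3$ such that the following holds for every $N\ge1$ and every smooth $m:\mathbb R\to\mathbb R$ that is nonincreasing on $[0,\infty)$ and nondecreasing on $(-\infty,0]$ and satisfies $m(\xi)=1$ for $|\xi|<N$, $m(\xi)=N^{-s}|\xi|^s$ for $|\xi|\ge10N$, and $|m'(\xi)|\le A/N$ for all $\xi$ (for instance $m(\xi)=m_1(\xi/N)$ with a fixed profile $m_1$ with $|m_1'|\le A$). Let $I$ be the Fourier multiplier in $x$ with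 symbol $m$, that is $\widehat{Iu}=m(\xi)\,\hat u$. Then $$\big\|\partial_x\{I(u)\,I(v)-I(uv)\}\big\|_{X^{0,-\frac12-\varepsilon_1}}\le C\,N^{-\frac34+\varepsilon_2}\,\|Iu\|_{X^{0,\frac12+\varepsilon_3}}\,\|Iv\|_{X^{0,\frac12+\varepsilon_3}}$$ for all Schwartz functions $u,v$ on $\mathbb R^2$, and more generally for all $u,v$ with $Iu,Iv\in X^{0,\frac12+\varepsilon_3}$. In the general case the products are understood through their Fourier transforms, $\widehat{fg}=(2\pi)^{-2}\,\hat f*\hat g$, and the convolution integrals for $I(u)I(v)$ and for $uv$ converge absolutely for almost every $(\tau,\xi)$. -/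

import Mathlib

open MeasureTheory
open scoped ENNReal ContDiff SchwartzMap

namespace ExtraSmoothing

noncomputable section

/-- The spatial Fourier transform `∫ e^{-i x ξ} f(x) dx`. -/
def spatialFourier (f : ℝ → ℂ) (ξ : ℝ) : ℂ :=
  ∫ x : ℝ, Complex.exp (-(Complex.I * ((x : ℂ) * (ξ : ℂ)))) * f x

/-- The spacetime Fourier transform `∫∫ e^{-i (x ξ + t τ)} u(t,x) dt dx`.
Points of physical space are written `(t, x)`, points of frequency space `(τ, ξ)`. -/
def spacetimeFourier (u : ℝ × ℝ → ℂ) (p : ℝ × ℝ) : ℂ :=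
  ∫ q : ℝ × ℝ,
    Complex.exp (-(Complex.I * ((q.2 : ℂ) * (p.2 : ℂ) + (q.1 : ℂ) * (p.1 : ℂ)))) * u q

/-- The spatial Fourier multiplier operator with symbol `m`:
at each time `t`, the spatial Fourier transform of `u(t, ·)` is multiplied by `m(ξ)`. -/
def multiplierOp (m : ℝ → ℝ) (u : ℝ × ℝ → ℂ) (q : ℝ × ℝ) : ℂ :=
  (1 / (2 * (Real.pi : ℂ))) * ∫ ξ : ℝ,
    Complex.exp (Complex.I * ((q.2 : ℂ) * (ξ : ℂ))) *
      ((m ξ : ℂ) * spatialFourier (fun x => u (q.1, x)) ξ)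

/-- The spatial derivative `∂ₓ u (t, x)`. -/
def dx (u : ℝ × ℝ → ℂ) (q : ℝ × ℝ) : ℂ := deriv (fun x : ℝ => u (q.1, x)) q.2

/-- The `X^{s,b}` norm in terms of the spacetime Fourier transform `F = F(τ, ξ)`:
`(∫∫ |F|² (1+|ξ|)^{2s} (1+|τ-ξ³|)^{2b} dξ dτ)^{1/2}`, with values in `[0, ∞]`. -/
def spectralNorm (s b : ℝ) (F : ℝ × ℝ → ℂ) : ℝ≥0∞ :=
  (∫⁻ p : ℝ × ℝ, ‖F p‖ₑ ^ 2 *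
    ENNReal.ofReal ((1 + |p.2|) ^ (2 * s) * (1 + |p.1 - p.2 ^ 3|) ^ (2 * b))) ^ (1 / 2 : ℝ)

/-- The `X^{s,b}` norm of a (rapidly decreasing) function on spacetime. -/
def xNorm (s b : ℝ) (u : ℝ × ℝ → ℂ) : ℝ≥0∞ := spectralNorm s b (spacetimeFourier u)

/-- The symbols of the operator `I`: smooth, monotone in `|ξ|`, equal to `1` for `|ξ| < N` and
to `N^{-s} |ξ|^s` for `|ξ| ≥ 10 N`. -/
structure IsSymbol (s N : ℝ) (m : ℝ → ℝ) : Prop where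
  smooth : ContDiff ℝ ∞ m
  antitoneOn : AntitoneOn m (Set.Ici 0)
  monotoneOn : MonotoneOn m (Set.Iic 0)
  low : ∀ ξ : ℝ, |ξ| < N → m ξ = 1
  high : ∀ ξ : ℝ, 10 * N ≤ |ξ| → m ξ = N ^ (-s) * |ξ| ^ s

/-- `∂ₓ { I(u) I(v) - I(u v) }`. -/
def commutator (m : ℝ → ℝ) (u v : ℝ × ℝ → ℂ) : ℝ × ℝ → ℂ :=
  dx (fun q => multiplierOp m u q * multiplierOp m v q
    - multiplierOp m (fun q' => u q' * v q') q)

/-! The same objects for a general `u` in the closure of the Schwartz functions. Since the norm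
only sees the spacetime Fourier transform, such a `u` is given by that transform, a measurable
function `U = U(τ, ξ)` with finite weighted `L²` norm. -/

/-- The spacetime Fourier transform of `I u`, when `U` is that of `u`. -/
def multiplierSpectrum (m : ℝ → ℝ) (U : ℝ × ℝ → ℂ) (p : ℝ × ℝ) : ℂ := (m p.2 : ℂ) * U p

/-- The spacetime Fourier transform `(2π)⁻² U * V` of the product `u v`,
when `U`, `V` are those of `u`, `v`. -/
def productSpectrum (U V : ℝ × ℝ → ℂ) (p : ℝ × ℝ) : ℂ :=
  (1 / (2 * (Real.pi : ℂ)) ^ 2) * ∫ q : ℝ × ℝ, U q * V (p - q)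

/-- The spacetime Fourier transform of `∂ₓ { I(u) I(v) - I(u v) }`,
when `U`, `V` are those of `u`, `v`. -/
def commutatorSpectrum (m : ℝ → ℝ) (U V : ℝ × ℝ → ℂ) (p : ℝ × ℝ) : ℂ :=
  Complex.I * (p.2 : ℂ) *
    (productSpectrum (multiplierSpectrum m U) (multiplierSpectrum m V) p
      - multiplierSpectrum m (productSpectrum U V) p)

end

end ExtraSmoothing

/-!
The estimate lives in frequency space. Write `ξ = ξ₁ + ξ₂`, `σ = τ - ξ³`, and let `σ₁`, `σ₂` be the
modulations of the two inputs. Relative to the transforms of `I u` and `I v`, the commutator has the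
symbol `|ξ| M(ξ₁, ξ₂)` with `M = |m(ξ₁) m(ξ₂) - m(ξ)| / (m(ξ₁) m(ξ₂))` (`relSymbol`), so one has to
bound the trilinear form with the kernel `|ξ| M` and the weights `(1 + |σⱼ|)^{-(1 + δ)/2}`, where `δ`
is the smaller of `2 ε₁` and `2 ε₃`.

The modulations satisfy `σ - σ₁ - σ₂ = -3 ξ ξ₁ ξ₂`, so one of them is at least `|ξ ξ₁ ξ₂|`
(`abs_mul_le_modulation`). On the region where it is the `j`-th, the trilinear form is estimated by
Cauchy–Schwarz with the `j`-th frequency fixed (`lintegral_sq_convolution_le`). The integral of the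
two other weights in the time frequency is a decaying function of `a - c (y - y₀)²`, where `y` is
the remaining spatial frequency and `c` is three times the `j`-th one, and for every such quadratic
polynomial
`∫ (|c| |y - y₀| + √|c|) (1 + |a - c (y - y₀)²|)^{-(1 + δ)} dy`
is bounded by a constant depending only on `δ` (`lintegral_quadratic_decayWeight_le`). The whole
estimate therefore reduces to the pointwise inequalities
`|ξ| M² ≤ C N^{-3/2} |ξ₁ ξ₂| (|ξ| |ξ₁ - ξ₂| + √|ξ|)` and
`|ξ| M² ≤ C N^{-3/2} |ξ₁ ξ₂| (|ξ₁| |ξ + ξ₂| + √|ξ₁|)`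
(`IsSymbol.output_bound`, `IsSymbol.input_bound`). They follow by comparing the sizes of the three
frequencies, the largest of which is at least `N / 2` unless `M = 0`. When all three are comparable,
`M ≤ C (|ξ₁| / N)^{3/4}` because `s > -3/4`; this is the case that fixes the power of `N`. When one
input is much smaller, the bound on `m'` gives `M ≤ C |ξ₂| / N`. This yields the power `N^{-3/4}`
itself, with no loss.

For general `U`, `V` the convolution for `u v` converges absolutely almost everywhere since
`m(ξ) ≤ (M + 1) m(ξ₁) m(ξ₂)`: the first term is controlled by the estimate and the second one by
Cauchy–Schwarz. Schwartz functions are reduced to their transforms: the symbol has temperate growth,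
so `I u` is a Schwartz function, and Fourier inversion and the convolution theorem identify the
transform of the commutator.
-/

namespace ExtraSmoothing

/-! ### The integrable weight `(1 + |x|)^{-(1 + δ)}` on the line -/

/-- The weight `(1 + |x|)^{-(1 + δ)}`, as an extended nonnegative real. It is integrable on the
line exactly when `δ > 0`. -/
noncomputable def decayWeight (δ x : ℝ) : ℝ≥0∞ := ENNReal.ofReal ((1 + |x|) ^ (-(1 + δ)))

/-- The total mass of `decayWeight δ`. -/
noncomputable def decayMass (δ : ℝ) : ℝ≥0∞ := ∫⁻ x, decayWeight δ x

@[fun_prop]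
lemma measurable_decayWeight (δ : ℝ) : Measurable (decayWeight δ) := by
  unfold decayWeight; fun_prop

lemma decayWeight_neg (δ x : ℝ) : decayWeight δ (-x) = decayWeight δ x := by
  simp [decayWeight]

lemma decayWeight_le_one {δ : ℝ} (hδ : 0 < δ) (x : ℝ) : decayWeight δ x ≤ 1 := by
  unfold decayWeight
  rw [← ENNReal.ofReal_one]
  apply ENNReal.ofReal_le_ofReal
  exact Real.rpow_le_one_of_one_le_of_nonpos (by linarith [abs_nonneg x]) (by linarith)

lemma decayMass_lt_top {δ : ℝ} (hδ : 0 < δ) : decayMass δ < ⊤ := by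
  have h := finite_integral_one_add_norm (E := ℝ) (μ := volume) (r := 1 + δ) (by simpa using hδ)
  simpa [decayMass, decayWeight, Real.norm_eq_abs] using h

lemma lintegral_decayWeight_sub (δ a : ℝ) : ∫⁻ t, decayWeight δ (t - a) = decayMass δ :=
  lintegral_sub_right_eq_self (decayWeight δ) a

/-- The larger of `1 + |x|`, `1 + |y|` is at least half of `1 + |x + y|`. -/
lemma decayWeight_mul_le {δ : ℝ} (hδ : 0 < δ) (x y : ℝ) :
    decayWeight δ x * decayWeight δ y ≤
      ENNReal.ofReal (2 ^ (1 + δ)) * decayWeight δ (x + y) *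
        (decayWeight δ x + decayWeight δ y) := by
  have key : ∀ x y : ℝ, |y| ≤ |x| →
      decayWeight δ x ≤ ENNReal.ofReal (2 ^ (1 + δ)) * decayWeight δ (x + y) := by
    intro x y hxy
    unfold decayWeight
    rw [← ENNReal.ofReal_mul (by positivity)]
    apply ENNReal.ofReal_le_ofReal
    have h1 : (1 + |x + y|) / 2 ≤ 1 + |x| := by
      have := abs_add_le x y
      linarith [abs_nonneg x]
    have h2 : (2 : ℝ) ^ (1 + δ) * (1 + |x + y|) ^ (-(1 + δ)) =
        ((1 + |x + y|) / 2) ^ (-(1 + δ)) := by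
      rw [Real.div_rpow (by positivity) (by norm_num), Real.rpow_neg (by norm_num : (0:ℝ) ≤ 2)]
      rw [div_inv_eq_mul, mul_comm]
    rw [h2]
    exact Real.rpow_le_rpow_of_nonpos (by positivity) h1 (by linarith)
  rcases le_total |y| |x| with h | h
  · calc _ ≤ _ := mul_le_mul_left (key x y h) _
      _ ≤ _ := by gcongr; exact le_add_self
  · rw [mul_comm]
    calc _ ≤ _ := mul_le_mul_left (key y x h) _
      _ ≤ _ := by rw [add_comm y x]; gcongr; exact le_self_add

lemma lintegral_decayWeight_mul_le {δ : ℝ} (hδ : 0 < δ) (a b : ℝ) :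
    ∫⁻ t, decayWeight δ (t - a) * decayWeight δ (b - t) ≤
      ENNReal.ofReal (2 ^ (1 + δ)) * (2 * decayMass δ) * decayWeight δ (b - a) := by
  calc _ ≤ ∫⁻ t, ENNReal.ofReal (2 ^ (1 + δ)) * decayWeight δ (b - a) *
        (decayWeight δ (t - a) + decayWeight δ (t - b)) := by
        apply lintegral_mono
        intro t
        have := decayWeight_mul_le hδ (t - a) (b - t)
        rw [show t - a + (b - t) = b - a by ring] at this
        simp only
        rwa [← decayWeight_neg δ (t - b), neg_sub]
    _ = _ := by
        rw [lintegral_const_mul _ (by fun_prop), lintegral_add_left (by fun_prop),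
          lintegral_decayWeight_sub, lintegral_decayWeight_sub]
        ring

/-- The substitution `x = a - c y²` on either half-line. -/
lemma lintegral_abs_mul_decayWeight_le (δ a c : ℝ) :
    ∫⁻ y, ENNReal.ofReal (|c| * |y|) * decayWeight δ (a - c * y ^ 2) ≤ decayMass δ := by
  rcases eq_or_ne c 0 with rfl | hc
  · simp
  have half : ∀ s : Set ℝ, MeasurableSet s → Set.InjOn (fun y : ℝ => a - c * y ^ 2) s →
      2 * ∫⁻ y in s, ENNReal.ofReal (|c| * |y|) * decayWeight δ (a - c * y ^ 2) ≤
        decayMass δ := by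
    intro s hs hinj
    have h := lintegral_image_eq_lintegral_abs_deriv_mul (f := fun y : ℝ => a - c * y ^ 2)
      (f' := fun y => -(c * (2 * y))) hs (fun x _ => by
        have := (((hasDerivAt_id x).pow 2).const_mul c).const_sub a
        simpa using this.hasDerivWithinAt) hinj (decayWeight δ)
    rw [← lintegral_const_mul _ (by fun_prop)]
    calc _ = ∫⁻ x in (fun y : ℝ => a - c * y ^ 2) '' s, decayWeight δ x := by
          rw [h]
          congr 1
          ext y
          rw [← mul_assoc, show (2 : ℝ≥0∞) = ENNReal.ofReal 2 by simp,
            ← ENNReal.ofReal_mul (by norm_num)]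
          congr 2
          rw [abs_neg, abs_mul, abs_mul, abs_two]; ring
      _ ≤ _ := setLIntegral_le_lintegral _ _
  have inj : ∀ x y : ℝ, 0 ≤ x * y → a - c * x ^ 2 = a - c * y ^ 2 → x = y := by
    intro x y hxy h
    have h2 : c * ((x - y) * (x + y)) = 0 := by linarith
    rcases mul_eq_zero.1 ((mul_eq_zero.1 h2).resolve_left hc) with h | h
    · linarith
    · have : y = -x := by linarith
      subst this
      have : x = 0 := by nlinarith
      simp [this]
  have h1 := half (Set.Ici 0) measurableSet_Ici
    (fun x hx y hy h => inj x y (mul_nonneg hx hy) h)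
  have h2 := half (Set.Iio 0) measurableSet_Iio
    (fun x hx y hy h => inj x y (mul_nonneg_of_nonpos_of_nonpos (le_of_lt hx) (le_of_lt hy)) h)
  rw [← lintegral_add_compl _ (measurableSet_Ici (a := (0:ℝ))), Set.compl_Ici]
  have := add_le_add h1 h2
  rw [← mul_add, ← two_mul] at this
  exact (ENNReal.mul_le_mul_iff_right (by norm_num) (by norm_num)).1 this

/-- The bound is uniform in the quadratic polynomial `a - c (y - y₀)²`: near its critical point the
weight `√|c|` is matched by the length `2 / √|c|` of the interval `|y - y₀| ≤ 1 / √|c|`, and off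
that interval it is dominated by `|c| |y - y₀|`, half of the derivative. -/
lemma lintegral_quadratic_decayWeight_le {δ : ℝ} (hδ : 0 < δ) (a c y₀ : ℝ) :
    ∫⁻ y, ENNReal.ofReal (|c| * |y - y₀| + √|c|) * decayWeight δ (a - c * (y - y₀) ^ 2) ≤
      2 * decayMass δ + 2 := by
  rw [lintegral_sub_right_eq_self (fun y => ENNReal.ofReal (|c| * |y| + √|c|) *
    decayWeight δ (a - c * y ^ 2)) y₀]
  rcases eq_or_ne c 0 with rfl | hc
  · simp
  have hc' : 0 < √|c| := Real.sqrt_pos.2 (abs_pos.2 hc)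
  set s : Set ℝ := Set.Icc (-(1 / √|c|)) (1 / √|c|) with hs
  have pt : ∀ y : ℝ, ENNReal.ofReal (|c| * |y| + √|c|) * decayWeight δ (a - c * y ^ 2) ≤
      2 * (ENNReal.ofReal (|c| * |y|) * decayWeight δ (a - c * y ^ 2)) +
        s.indicator (fun _ => ENNReal.ofReal (√|c|)) y := by
    intro y
    rw [ENNReal.ofReal_add (by positivity) hc'.le, add_mul, two_mul, add_assoc]
    gcongr
    by_cases hy : y ∈ s
    · rw [Set.indicator_of_mem hy]
      calc _ ≤ ENNReal.ofReal (√|c|) * 1 := by gcongr; exact decayWeight_le_one hδ _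
        _ ≤ _ := by rw [mul_one]; exact le_add_self
    · rw [Set.indicator_of_notMem hy, add_zero]
      gcongr
      have : 1 / √|c| ≤ |y| := by
        rw [hs, Set.mem_Icc, ← abs_le] at hy
        exact le_of_not_ge hy
      calc √|c| = |c| * (1 / √|c|) := by
            rw [mul_one_div, eq_div_iff hc'.ne', Real.mul_self_sqrt (abs_nonneg c)]
        _ ≤ _ := by gcongr
  refine (lintegral_mono pt).trans ?_
  rw [lintegral_add_left (by fun_prop), lintegral_const_mul _ (by fun_prop),
    lintegral_indicator measurableSet_Icc, setLIntegral_const, Real.volume_Icc,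
    ← ENNReal.ofReal_mul hc'.le]
  gcongr
  · exact lintegral_abs_mul_decayWeight_le δ a c
  · rw [show √|c| * (1 / √|c| - -(1 / √|c|)) = 2 by field_simp; norm_num]
    simp

/-! ### Trilinear Cauchy–Schwarz estimates -/

section Trilinear

variable {α β : Type*} [MeasurableSpace α] [MeasurableSpace β] {μ : Measure α} {ν : Measure β}

/-- The Cauchy–Schwarz inequality for lower integrals. -/
lemma sq_lintegral_mul_le {f g : α → ℝ≥0∞} (hf : AEMeasurable f μ) (hg : AEMeasurable g μ) :
    (∫⁻ x, f x * g x ∂μ) ^ 2 ≤ (∫⁻ x, f x ^ 2 ∂μ) * ∫⁻ x, g x ^ 2 ∂μ := by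
  have h := ENNReal.lintegral_mul_le_Lp_mul_Lq μ Real.HolderConjugate.two_two hf hg
  have h2 := pow_le_pow_left' h 2
  rw [mul_pow, ← ENNReal.rpow_mul_natCast, ← ENNReal.rpow_mul_natCast] at h2
  simpa using h2

/-- Cauchy–Schwarz in `y` for each `x`, then in `x`. -/
lemma sq_lintegral_lintegral_mul_le [SFinite ν] {a : α → ℝ≥0∞} {k b : α → β → ℝ≥0∞}
    {S : ℝ≥0∞} (ha : Measurable a) (hk : Measurable (Function.uncurry k))
    (hb : Measurable (Function.uncurry b)) (hS : ∀ x, ∫⁻ y, k x y ^ 2 ∂ν ≤ S) :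
    (∫⁻ x, ∫⁻ y, a x * (k x y * b x y) ∂ν ∂μ) ^ 2 ≤
      S * (∫⁻ x, a x ^ 2 ∂μ) * ∫⁻ x, ∫⁻ y, b x y ^ 2 ∂ν ∂μ := by
  have hkb : Measurable (fun x => ∫⁻ y, k x y * b x y ∂ν) :=
    Measurable.lintegral_prod_right' (hk.mul hb)
  have hk1 : ∀ x, Measurable (k x) := fun x => hk.of_uncurry_left
  have hb1 : ∀ x, Measurable (b x) := fun x => hb.of_uncurry_left
  have h1 : ∀ x, ∫⁻ y, a x * (k x y * b x y) ∂ν = a x * ∫⁻ y, k x y * b x y ∂ν := fun x =>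
    lintegral_const_mul _ ((hk1 x).mul (hb1 x))
  simp_rw [h1]
  refine (sq_lintegral_mul_le ha.aemeasurable hkb.aemeasurable).trans ?_
  rw [mul_comm S, mul_assoc]
  gcongr
  have hb2 : Measurable (fun x => ∫⁻ y, b x y ^ 2 ∂ν) :=
    Measurable.lintegral_prod_right' (hb.pow_const 2)
  rw [← lintegral_const_mul _ hb2]
  apply lintegral_mono
  intro x
  refine (sq_lintegral_mul_le (hk1 x).aemeasurable (hb1 x).aemeasurable).trans ?_
  exact mul_le_mul_left (hS x) _

/-- The dual characterization of the `L²` norm. The test functions are the truncations of `T`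
to bounded functions on sets of finite measure. -/
lemma lintegral_sq_le_of_forall_test [SigmaFinite μ] {T : α → ℝ≥0∞} (hT : Measurable T)
    {B : ℝ≥0∞}
    (h : ∀ g : α → ℝ≥0∞, Measurable g → (∫⁻ x, g x * T x ∂μ) ^ 2 ≤ B * ∫⁻ x, g x ^ 2 ∂μ) :
    ∫⁻ x, T x ^ 2 ∂μ ≤ B := by
  set Tn : ℕ → α → ℝ≥0∞ := fun n => (spanningSets μ n).indicator (fun x => min (T x) n) with hTn
  have hmeas : ∀ n, Measurable (Tn n) := fun n =>
    (hT.min measurable_const).indicator (measurableSet_spanningSets μ n)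
  have hle : ∀ n x, Tn n x ≤ T x := fun n x =>
    (Set.indicator_le_self' (fun _ _ => zero_le) x).trans (min_le_left _ _)
  have hmono : Monotone (fun n x => Tn n x ^ 2) := by
    intro n k hnk x
    have : Tn n x ≤ Tn k x := by
      simp only [hTn]
      refine (Set.indicator_le_indicator_of_subset (monotone_spanningSets μ hnk)
        (fun _ => zero_le) x).trans ?_
      apply Set.indicator_le_indicator
      gcongr
    exact pow_le_pow_left' this 2
  have hsup : ∀ x, ⨆ n, Tn n x ^ 2 = T x ^ 2 := by
    intro x
    apply le_antisymm
    · exact iSup_le fun n => pow_le_pow_left' (hle n x) 2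
    · have hlim : Filter.Tendsto (fun n => Tn n x) Filter.atTop (nhds (T x)) := by
        have h1 : Filter.Tendsto (fun n : ℕ => min (T x) (n : ℝ≥0∞)) Filter.atTop
            (nhds (min (T x) ⊤)) := tendsto_const_nhds.min ENNReal.tendsto_nat_nhds_top
        rw [min_top_right] at h1
        refine h1.congr' ?_
        have hx : x ∈ ⋃ n, spanningSets μ n := by rw [iUnion_spanningSets]; trivial
        obtain ⟨n, hn⟩ := Set.mem_iUnion.1 hx
        filter_upwards [Filter.eventually_ge_atTop n] with k hk
        simp only [hTn]
        rw [Set.indicator_of_mem (monotone_spanningSets μ hk hn)]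
      exact le_of_tendsto' (ENNReal.Tendsto.pow hlim) fun n => le_iSup (fun n => Tn n x ^ 2) n
  have hbound : ∀ n, ∫⁻ x, Tn n x ^ 2 ∂μ ≤ B := by
    intro n
    have hfin : ∫⁻ x, Tn n x ^ 2 ∂μ ≠ ⊤ := by
      have : ∫⁻ x, Tn n x ^ 2 ∂μ ≤ ∫⁻ x in spanningSets μ n, (n : ℝ≥0∞) ^ 2 ∂μ := by
        rw [← lintegral_indicator (measurableSet_spanningSets μ n)]
        apply lintegral_mono
        intro x
        by_cases hx : x ∈ spanningSets μ n
        · simp only [hTn, Set.indicator_of_mem hx]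
          exact pow_le_pow_left' (min_le_right _ _) 2
        · simp [hTn, Set.indicator_of_notMem hx]
      refine (this.trans_lt ?_).ne
      rw [setLIntegral_const]
      exact ENNReal.mul_lt_top (by simp) (measure_spanningSets_lt_top μ n)
    have h1 : (∫⁻ x, Tn n x ^ 2 ∂μ) ^ 2 ≤ B * ∫⁻ x, Tn n x ^ 2 ∂μ := by
      refine le_trans ?_ (h (Tn n) (hmeas n))
      gcongr with x
      rw [sq]
      gcongr
      exact hle n x
    rcases eq_or_ne (∫⁻ x, Tn n x ^ 2 ∂μ) 0 with h0 | h0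
    · rw [h0]; exact zero_le
    · rw [sq] at h1
      exact (ENNReal.mul_le_mul_iff_left h0 hfin).1 h1
  simp_rw [← hsup]
  rw [lintegral_iSup (fun n => (hmeas n).pow_const 2) hmono]
  exact iSup_le hbound

end Trilinear

section Convolution

variable {G : Type*} [AddCommGroup G] [MeasurableSpace G] [MeasurableAdd₂ G] [MeasurableNeg G]
  {μ : Measure G} [SigmaFinite μ] [μ.IsAddLeftInvariant]

lemma lintegral_lintegral_mul_sub_sq {f g : G → ℝ≥0∞} (hf : Measurable f) (hg : Measurable g) :
    ∫⁻ p, ∫⁻ q, (f q * g (p - q)) ^ 2 ∂μ ∂μ = (∫⁻ q, f q ^ 2 ∂μ) * ∫⁻ q, g q ^ 2 ∂μ := by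
  rw [lintegral_lintegral_swap (by fun_prop)]
  simp_rw [mul_pow]
  have : ∀ q, ∫⁻ p, f q ^ 2 * g (p - q) ^ 2 ∂μ = f q ^ 2 * ∫⁻ p, g p ^ 2 ∂μ := by
    intro q
    rw [lintegral_const_mul _ (by fun_prop)]
    congr 1
    exact lintegral_sub_right_eq_self (fun p => g p ^ 2) q
  simp_rw [this]
  rw [lintegral_mul_const _ (by fun_prop)]

lemma sq_trilinear_le_of_output {h f g : G → ℝ≥0∞} {k : G → G → ℝ≥0∞} {S : ℝ≥0∞}
    (hh : Measurable h) (hf : Measurable f) (hg : Measurable g)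
    (hk : Measurable (Function.uncurry k)) (hS : ∀ p, ∫⁻ q, k p q ^ 2 ∂μ ≤ S) :
    (∫⁻ p, ∫⁻ q, h p * (k p q * (f q * g (p - q))) ∂μ ∂μ) ^ 2 ≤
      S * ((∫⁻ q, f q ^ 2 ∂μ) * ∫⁻ q, g q ^ 2 ∂μ) * ∫⁻ p, h p ^ 2 ∂μ := by
  refine (sq_lintegral_lintegral_mul_le hh hk (b := fun p q => f q * g (p - q))
    (by unfold Function.uncurry; fun_prop) hS).trans_eq ?_
  rw [lintegral_lintegral_mul_sub_sq hf hg]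
  ring

lemma sq_trilinear_le_of_left [μ.IsNegInvariant] {h f g : G → ℝ≥0∞} {k : G → G → ℝ≥0∞} {S : ℝ≥0∞}
    (hh : Measurable h) (hf : Measurable f) (hg : Measurable g)
    (hk : Measurable (Function.uncurry k)) (hS : ∀ q, ∫⁻ p, k p q ^ 2 ∂μ ≤ S) :
    (∫⁻ p, ∫⁻ q, h p * (k p q * (f q * g (p - q))) ∂μ ∂μ) ^ 2 ≤
      S * ((∫⁻ q, f q ^ 2 ∂μ) * ∫⁻ q, g q ^ 2 ∂μ) * ∫⁻ p, h p ^ 2 ∂μ := by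
  have hkm : Measurable (fun z : G × G => k z.1 z.2) := hk
  rw [lintegral_lintegral_swap (by unfold Function.uncurry; fun_prop)]
  calc _ = (∫⁻ q, ∫⁻ p, f q * (k p q * (h p * g (p - q))) ∂μ ∂μ) ^ 2 := by
        congr 4 with q; congr 1 with p; ring
    _ ≤ _ := sq_lintegral_lintegral_mul_le hf (k := fun q p => k p q)
        (b := fun q p => h p * g (p - q)) (hkm.comp measurable_swap)
        (by unfold Function.uncurry; fun_prop) hS
    _ = _ := by
        have : ∫⁻ q, ∫⁻ p, (h p * g (p - q)) ^ 2 ∂μ ∂μ =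
            (∫⁻ p, h p ^ 2 ∂μ) * ∫⁻ q, g q ^ 2 ∂μ := by
          rw [lintegral_lintegral_swap (by unfold Function.uncurry; fun_prop)]
          simp_rw [mul_pow]
          rw [← lintegral_mul_const _ (by fun_prop)]
          congr 1 with p
          rw [lintegral_const_mul _ (by fun_prop)]
          congr 1
          exact lintegral_sub_left_eq_self (fun p => g p ^ 2) p
        rw [this]; ring

lemma sq_trilinear_le_of_right [μ.IsNegInvariant] {h f g : G → ℝ≥0∞} {k : G → G → ℝ≥0∞} {S : ℝ≥0∞}
    (hh : Measurable h) (hf : Measurable f) (hg : Measurable g)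
    (hk : Measurable (Function.uncurry k)) (hS : ∀ q, ∫⁻ p, k p (p - q) ^ 2 ∂μ ≤ S) :
    (∫⁻ p, ∫⁻ q, h p * (k p q * (f q * g (p - q))) ∂μ ∂μ) ^ 2 ≤
      S * ((∫⁻ q, f q ^ 2 ∂μ) * ∫⁻ q, g q ^ 2 ∂μ) * ∫⁻ p, h p ^ 2 ∂μ := by
  have hkm : Measurable (fun z : G × G => k z.1 z.2) := hk
  have h1 := sq_trilinear_le_of_left (μ := μ) hh hg hf (k := fun p q => k p (p - q))
    (hkm.comp (measurable_fst.prodMk (measurable_fst.sub measurable_snd))) hS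
  rw [mul_comm (∫⁻ q, f q ^ 2 ∂μ)]
  refine le_trans (le_of_eq ?_) h1
  congr 2 with p
  rw [← lintegral_sub_left_eq_self _ p]
  congr 1 with q
  rw [sub_sub_cancel, mul_comm (f (p - q))]

/-- A bilinear `L² × L² → L²` estimate for a convolution with a kernel. It suffices to split the
kernel in three pieces, each of which is square integrable in one pair of variables, uniformly in
the remaining one: the output variable `p`, or one of the input variables `q`, `p - q`. -/
lemma lintegral_sq_convolution_le [μ.IsNegInvariant] {f g : G → ℝ≥0∞} {k k₀ k₁ k₂ : G → G → ℝ≥0∞} {S : ℝ≥0∞}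
    (hf : Measurable f) (hg : Measurable g)
    (hk : Measurable (Function.uncurry k)) (hk₀ : Measurable (Function.uncurry k₀))
    (hk₁ : Measurable (Function.uncurry k₁)) (hk₂ : Measurable (Function.uncurry k₂))
    (hle : ∀ p q, k p q ≤ k₀ p q + k₁ p q + k₂ p q)
    (hS₀ : ∀ p, ∫⁻ q, k₀ p q ^ 2 ∂μ ≤ S) (hS₁ : ∀ q, ∫⁻ p, k₁ p q ^ 2 ∂μ ≤ S)
    (hS₂ : ∀ q, ∫⁻ p, k₂ p (p - q) ^ 2 ∂μ ≤ S) :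
    ∫⁻ p, (∫⁻ q, k p q * (f q * g (p - q)) ∂μ) ^ 2 ∂μ ≤
      9 * (S * ((∫⁻ q, f q ^ 2 ∂μ) * ∫⁻ q, g q ^ 2 ∂μ)) := by
  have hkm : Measurable (fun z : G × G => k z.1 z.2) := hk
  have hkm₀ : Measurable (fun z : G × G => k₀ z.1 z.2) := hk₀
  have hkm₁ : Measurable (fun z : G × G => k₁ z.1 z.2) := hk₁
  have hkm₂ : Measurable (fun z : G × G => k₂ z.1 z.2) := hk₂
  apply lintegral_sq_le_of_forall_test
  · exact Measurable.lintegral_prod_right' (f := fun z : G × G => k z.1 z.2 *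
      (f z.2 * g (z.1 - z.2))) (by fun_prop)
  intro h hh
  set B := S * ((∫⁻ q, f q ^ 2 ∂μ) * ∫⁻ q, g q ^ 2 ∂μ) * ∫⁻ p, h p ^ 2 ∂μ with hB
  have m : ∀ k' : G → G → ℝ≥0∞, Measurable (Function.uncurry k') → Measurable
      (fun z : G × G => h z.1 * (k' z.1 z.2 * (f z.2 * g (z.1 - z.2)))) := by
    intro k' hk'
    have : Measurable (fun z : G × G => k' z.1 z.2) := hk'
    fun_prop
  have m1 : ∀ k' : G → G → ℝ≥0∞, Measurable (Function.uncurry k') → ∀ p, Measurable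
      (fun q => h p * (k' p q * (f q * g (p - q)))) := fun k' hk' p =>
    (m k' hk').comp measurable_prodMk_left
  have e0 := sq_trilinear_le_of_output (μ := μ) hh hf hg hk₀ hS₀
  have e1 := sq_trilinear_le_of_left (μ := μ) hh hf hg hk₁ hS₁
  have e2 := sq_trilinear_le_of_right (μ := μ) hh hf hg hk₂ hS₂
  rw [← hB] at e0 e1 e2
  set t₀ := ∫⁻ p, ∫⁻ q, h p * (k₀ p q * (f q * g (p - q))) ∂μ ∂μ
  set t₁ := ∫⁻ p, ∫⁻ q, h p * (k₁ p q * (f q * g (p - q))) ∂μ ∂μ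
  set t₂ := ∫⁻ p, ∫⁻ q, h p * (k₂ p q * (f q * g (p - q))) ∂μ ∂μ
  have hsum : ∫⁻ p, h p * ∫⁻ q, k p q * (f q * g (p - q)) ∂μ ∂μ ≤ t₀ + t₁ + t₂ := by
    calc _ ≤ ∫⁻ p, ((∫⁻ q, h p * (k₀ p q * (f q * g (p - q))) ∂μ) +
          (∫⁻ q, h p * (k₁ p q * (f q * g (p - q))) ∂μ)) +
          (∫⁻ q, h p * (k₂ p q * (f q * g (p - q))) ∂μ) ∂μ := by
          apply lintegral_mono
          intro p
          have : Measurable (fun q => k p q * (f q * g (p - q))) := by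
            have := hk.of_uncurry_left (x := p)
            fun_prop
          simp only
          rw [← lintegral_const_mul _ this, ← lintegral_add_left (m1 k₀ hk₀ p),
            ← lintegral_add_right _ (m1 k₂ hk₂ p)]
          apply lintegral_mono
          intro q
          simp only
          rw [← mul_add, ← mul_add, ← add_mul, ← add_mul]
          gcongr
          exact hle p q
      _ = _ := by
          rw [lintegral_add_right _ (m k₂ hk₂).lintegral_prod_right',
            lintegral_add_right _ (m k₁ hk₁).lintegral_prod_right']
  have h3 : t₀ + t₁ + t₂ ≤ 3 * max t₀ (max t₁ t₂) := by
    calc _ ≤ max t₀ (max t₁ t₂) + max t₀ (max t₁ t₂) + max t₀ (max t₁ t₂) := by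
          gcongr <;> simp
      _ = _ := by ring
  calc _ ≤ (3 * max t₀ (max t₁ t₂)) ^ 2 := pow_le_pow_left' (hsum.trans h3) 2
    _ = 9 * (max t₀ (max t₁ t₂)) ^ 2 := by ring
    _ ≤ 9 * B := by
        gcongr
        rcases max_choice t₀ (max t₁ t₂) with h | h
        · rwa [h]
        · rw [h]
          rcases max_choice t₁ t₂ with h | h <;> rwa [h]
    _ = _ := by rw [hB]; ring

end Convolution

/-! ### Pointwise bounds on the symbol of the commutator -/

/-- The symbol of the commutator relative to `I u`, `I v`: the size of
`m(x) m(y) - m(x + y)` divided by `m(x) m(y)`. -/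
noncomputable def relSymbol (m : ℝ → ℝ) (x y : ℝ) : ℝ :=
  |m x * m y - m (x + y)| / (m x * m y)

lemma relSymbol_comm (m : ℝ → ℝ) (x y : ℝ) : relSymbol m x y = relSymbol m y x := by
  unfold relSymbol; rw [mul_comm, add_comm]

namespace IsSymbol

variable {s N : ℝ} {m : ℝ → ℝ}

lemma le_one (hm : IsSymbol s N m) (hN : 1 ≤ N) (x : ℝ) : m x ≤ 1 := by
  have h0 : m 0 = 1 := hm.low 0 (by simpa using by linarith)
  rw [← h0]
  rcases le_total 0 x with h | h
  · exact hm.antitoneOn (Set.mem_Ici.2 le_rfl) h h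
  · exact hm.monotoneOn h (Set.mem_Iic.2 le_rfl) h

lemma high' (hm : IsSymbol s N m) (hN : 1 ≤ N) {x : ℝ} (hx : 10 * N ≤ |x|) :
    m x = (|x| / N) ^ s := by
  rw [hm.high x hx, Real.div_rpow (abs_nonneg x) (by linarith), Real.rpow_neg (by linarith),
    div_eq_inv_mul]

lemma le_of_abs_le (hm : IsSymbol s N m) (hN : 1 ≤ N) {x : ℝ} (hx : |x| ≤ 10 * N) :
    (10 : ℝ) ^ s ≤ m x := by
  have hNpos : 0 < N := by linarith
  rw [abs_le] at hx
  rcases le_total 0 x with h | h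
  · have h1 := hm.high' hN (x := 10 * N) (le_abs_self _)
    rw [abs_of_pos (by positivity), mul_div_cancel_right₀ _ hNpos.ne'] at h1
    rw [← h1]
    exact hm.antitoneOn h (Set.mem_Ici.2 (by positivity)) hx.2
  · have h1 := hm.high' hN (x := -(10 * N)) (by rw [abs_neg]; exact le_abs_self _)
    rw [abs_neg, abs_of_pos (by positivity), mul_div_cancel_right₀ _ hNpos.ne'] at h1
    rw [← h1]
    exact hm.monotoneOn (Set.mem_Iic.2 (by linarith)) h hx.1

lemma tenth_le (hm : IsSymbol s N m) (hs : -3 / 4 < s) (hN : 1 ≤ N) {x : ℝ}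
    (hx : |x| ≤ 10 * N) : 1 / 10 ≤ m x := by
  refine le_trans ?_ (hm.le_of_abs_le hN hx)
  rw [one_div, ← Real.rpow_neg_one]
  exact Real.rpow_le_rpow_of_exponent_le (by norm_num) (by linarith)

lemma pos (hm : IsSymbol s N m) (hs : -3 / 4 < s) (hN : 1 ≤ N) (x : ℝ) : 0 < m x := by
  rcases le_total |x| (10 * N) with h | h
  · linarith [hm.tenth_le hs hN h]
  · rw [hm.high' hN h]
    exact Real.rpow_pos_of_pos (div_pos (by linarith) (by linarith)) _

/-- The symbol is at most a constant times the power profile, at every frequency. -/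
lemma le_rpow (hm : IsSymbol s N m) (hs : -3 / 4 < s) (hs0 : s < 0) (hN : 1 ≤ N) {x : ℝ}
    (hx : x ≠ 0) : m x ≤ 10 * (|x| / N) ^ s := by
  have hxN : 0 < |x| / N := div_pos (abs_pos.2 hx) (by linarith)
  rcases le_total |x| (10 * N) with h | h
  · refine (hm.le_one hN x).trans ?_
    have h1 : (10 : ℝ) ^ s ≤ (|x| / N) ^ s :=
      Real.rpow_le_rpow_of_nonpos hxN (by rw [div_le_iff₀ (by linarith)]; exact h) hs0.le
    have h2 : (10 : ℝ)⁻¹ ≤ 10 ^ s := by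
      rw [← Real.rpow_neg_one]
      exact Real.rpow_le_rpow_of_exponent_le (by norm_num) (by linarith)
    linarith
  · rw [hm.high' hN h]
    linarith [Real.rpow_pos_of_pos hxN s]

/-- The symbol is at least a constant times the power profile, away from the frequencies much
smaller than `N`. -/
lemma rpow_le (hm : IsSymbol s N m) (hs : -3 / 4 < s) (hs0 : s < 0) (hN : 1 ≤ N) {x : ℝ}
    (hx : N / 8 ≤ |x|) : (|x| / N) ^ s ≤ 80 * m x := by
  rcases le_total |x| (10 * N) with h | h
  · have h1 : (|x| / N) ^ s ≤ (1 / 8 : ℝ) ^ s :=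
      Real.rpow_le_rpow_of_nonpos (by norm_num)
        (by rw [le_div_iff₀ (by linarith)]; linarith) hs0.le
    have h2 : (1 / 8 : ℝ) ^ s ≤ 8 := by
      rw [one_div, Real.inv_rpow (by norm_num), ← Real.rpow_neg (by norm_num)]
      calc (8 : ℝ) ^ (-s) ≤ 8 ^ (1 : ℝ) :=
            Real.rpow_le_rpow_of_exponent_le (by norm_num) (by linarith)
        _ = 8 := Real.rpow_one 8
    linarith [hm.tenth_le hs hN h]
  · rw [hm.high' hN h]
    linarith [Real.rpow_pos_of_pos (show 0 < |x| / N from div_pos (by linarith) (by linarith)) s]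

lemma relSymbol_nonneg (hm : IsSymbol s N m) (hs : -3 / 4 < s) (hN : 1 ≤ N) (x y : ℝ) :
    0 ≤ relSymbol m x y :=
  div_nonneg (abs_nonneg _) (mul_pos (hm.pos hs hN x) (hm.pos hs hN y)).le

lemma relSymbol_le (hm : IsSymbol s N m) (hs : -3 / 4 < s) (hN : 1 ≤ N) (x y : ℝ) :
    relSymbol m x y ≤ 1 + m (x + y) / (m x * m y) := by
  have hxy := mul_pos (hm.pos hs hN x) (hm.pos hs hN y)
  have hz := hm.pos hs hN (x + y)
  unfold relSymbol
  rw [← div_self hxy.ne', ← add_div, div_le_div_iff_of_pos_right hxy, abs_le]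
  constructor <;> linarith

lemma relSymbol_eq_zero (hm : IsSymbol s N m) {x y : ℝ}
    (hx : |x| < N / 2) (hy : |y| ≤ |x|) : relSymbol m x y = 0 := by
  have h := abs_add_le x y
  have hpos := abs_nonneg x
  unfold relSymbol
  rw [hm.low x (by linarith), hm.low y (by linarith), hm.low (x + y) (by linarith)]
  simp

/-- For interacting frequencies of very different sizes the symbol gains a factor `|y| / N`:
by the mean value theorem, or by the power profile of `m` at high frequencies, when `|y| < N`, and
by its size when `|y| ≥ N`. -/
lemma relSymbol_le_of_separated (hm : IsSymbol s N m) (hs : -3 / 4 < s) (hs0 : s < 0)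
    (hN : 1 ≤ N) {A : ℝ} (hA : ∀ ξ, |deriv m ξ| ≤ A / N) {x y : ℝ} (hxN : N / 2 ≤ |x|)
    (hyx : |y| ≤ |x| / 4) : relSymbol m x y ≤ (128001 + 1600 * A) * (|y| / N) := by
  have hNpos : 0 < N := by linarith
  have hApos : 0 ≤ A := by
    have := (abs_nonneg _).trans (hA 0)
    by_contra h
    exact absurd this (not_le.2 (div_neg_of_neg_of_pos (not_le.1 h) hNpos))
  have hxpos : 0 < |x| := by linarith
  have hmx := hm.pos hs hN x
  have hmy := hm.pos hs hN y
  have hz1 : |x| * (3 / 4) ≤ |x + y| := by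
    have := abs_sub_abs_le_abs_sub x (-y)
    rw [abs_neg, sub_neg_eq_add] at this
    linarith
  have hz2 : |x + y| ≤ |x| * (5 / 4) := by linarith [abs_add_le x y]
  rcases le_or_gt N |y| with hNy | hNy
  · refine (hm.relSymbol_le hs hN x y).trans ?_
    have hyN1 : 1 ≤ |y| / N := by rw [le_div_iff₀ hNpos]; linarith
    have h1 : m (x + y) ≤ 1600 * m x := by
      have hz0 : x + y ≠ 0 := abs_pos.1 (by linarith)
      have h2 : (|x + y| / N) ^ s ≤ (3 / 4 * (|x| / N)) ^ s := by
        refine Real.rpow_le_rpow_of_nonpos (by positivity) ?_ hs0.le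
        rw [← mul_div_assoc]
        gcongr
        linarith
      have h3 : (3 / 4 : ℝ) ^ s ≤ 2 := by
        calc (3 / 4 : ℝ) ^ s ≤ (3 / 4 : ℝ) ^ (-1 : ℝ) :=
              Real.rpow_le_rpow_of_exponent_ge (by norm_num) (by norm_num) (by linarith)
          _ ≤ 2 := by rw [Real.rpow_neg_one]; norm_num
      rw [Real.mul_rpow (by norm_num) (by positivity)] at h2
      have h4 := hm.rpow_le hs hs0 hN (x := x) (by linarith)
      have h5 : (0 : ℝ) < (|x| / N) ^ s := by positivity
      linarith [hm.le_rpow hs hs0 hN hz0, mul_le_mul_of_nonneg_right h3 h5.le]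
    have h2 : 1 ≤ 80 * (|y| / N) * m y := by
      have h3 : (|y| / N)⁻¹ ≤ 80 * m y := by
        rw [← Real.rpow_neg_one]
        exact (Real.rpow_le_rpow_of_exponent_le hyN1 (by linarith)).trans
          (hm.rpow_le hs hs0 hN (by linarith))
      rw [inv_le_iff_one_le_mul₀ (by linarith)] at h3
      linarith
    have h3 : m (x + y) / (m x * m y) ≤ 128000 * (|y| / N) := by
      rw [div_le_iff₀ (mul_pos hmx hmy)]
      have := mul_le_mul_of_nonneg_left h2 hmx.le
      linarith
    have : 0 ≤ A * (|y| / N) := by positivity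
    linarith
  · have hrel : relSymbol m x y = |m x - m (x + y)| / m x := by
      unfold relSymbol; rw [hm.low y hNy, mul_one]
    have hyN0 : 0 ≤ |y| / N := by positivity
    rw [hrel, div_le_iff₀ hmx]
    rcases le_or_gt |x| (20 * N) with hx20 | hx20
    · have h1 : |m x - m (x + y)| ≤ A / N * |y| := by
        have h := Convex.norm_image_sub_le_of_norm_deriv_le (f := m) (C := A / N) (s := Set.univ)
          (fun z _ => hm.smooth.differentiable (by simp) z) (fun z _ => hA z) convex_univ
          (Set.mem_univ (x + y)) (Set.mem_univ x)
        simpa [Real.norm_eq_abs] using h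
      have h2 : 1 ≤ 1600 * m x := by
        have h3 : (20 : ℝ)⁻¹ ≤ (|x| / N) ^ s := by
          calc (20 : ℝ)⁻¹ ≤ 20 ^ s := by
                rw [← Real.rpow_neg_one]
                exact Real.rpow_le_rpow_of_exponent_le (by norm_num) (by linarith)
            _ ≤ _ := Real.rpow_le_rpow_of_nonpos (by positivity)
              (by rw [div_le_iff₀ hNpos]; exact hx20) hs0.le
        linarith [hm.rpow_le hs hs0 hN (x := x) (by linarith)]
      have h3 : A / N * |y| = A * (|y| / N) := by ring
      have h4 : A * (|y| / N) * 1 ≤ A * (|y| / N) * (1600 * m x) := by gcongr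
      have h5 : 0 ≤ |y| / N * m x := by positivity
      linarith
    · set ρ := |x + y| / |x| with hρ
      have hρ1 : 3 / 4 ≤ ρ := by rw [hρ, le_div_iff₀ hxpos]; linarith
      have hρpos : 0 < ρ := by linarith
      have hmz : m (x + y) = ρ ^ s * m x := by
        rw [hm.high' hN (x := x + y) (by linarith), hm.high' hN (x := x) (by linarith),
          ← Real.mul_rpow (by positivity) (by positivity), hρ]
        congr 1
        field_simp
      have hρy : |ρ - 1| ≤ |y| / N := by
        have h1 : |ρ - 1| ≤ |y| / |x| := by
          rw [hρ, div_sub_one hxpos.ne', abs_div, abs_abs x]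
          have := abs_abs_sub_abs_le (x + y) x
          rw [add_sub_cancel_left] at this
          exact div_le_div_of_nonneg_right this hxpos.le
        exact h1.trans (by gcongr; linarith)
      have hpow : |1 - ρ ^ s| ≤ 2 * |ρ - 1| := by
        rcases le_total 1 ρ with h | h
        · have h1 : ρ ^ s ≤ 1 := Real.rpow_le_one_of_one_le_of_nonpos h hs0.le
          have h2 : ρ⁻¹ ≤ ρ ^ s := by
            rw [← Real.rpow_neg_one]
            exact Real.rpow_le_rpow_of_exponent_le h (by linarith)
          have h3 : 1 - ρ⁻¹ ≤ ρ - 1 := by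
            have h4 : ρ * ρ⁻¹ = 1 := mul_inv_cancel₀ hρpos.ne'
            nlinarith [sq_nonneg (ρ - 1), inv_pos.2 hρpos]
          rw [abs_of_nonneg (by linarith), abs_of_nonneg (by linarith)]
          linarith
        · have h1 : 1 ≤ ρ ^ s := Real.one_le_rpow_of_pos_of_le_one_of_nonpos hρpos h hs0.le
          have h2 : ρ ^ s ≤ ρ⁻¹ := by
            rw [← Real.rpow_neg_one]
            exact Real.rpow_le_rpow_of_exponent_ge hρpos h (by linarith)
          have h3 : ρ⁻¹ - 1 ≤ 2 * (1 - ρ) := by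
            rw [sub_le_iff_le_add, inv_le_iff_one_le_mul₀ hρpos]
            nlinarith
          rw [abs_of_nonpos (by linarith), abs_of_nonpos (by linarith)]
          linarith
      rw [hmz, ← one_sub_mul, abs_mul, abs_of_pos hmx]
      gcongr
      have : 0 ≤ A * (|y| / N) := by positivity
      linarith

lemma inv_mul_le (hm : IsSymbol s N m) (hs : -3 / 4 < s) (hs0 : s < 0)
    (hN : 1 ≤ N) {x y : ℝ} (hxN : N / 2 ≤ |x|) (hyx : |y| ≤ |x|) (hxy : |x| / 4 ≤ |y|) :
    (m x * m y)⁻¹ ≤ 6400 * ((|x| / N) ^ (-s)) ^ 2 := by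
  have hxpos : 0 < |x| / N := div_pos (by linarith) (by linarith)
  have hypos : 0 < |y| / N := div_pos (by linarith) (by linarith)
  have h1 := hm.rpow_le hs hs0 hN (x := x) (by linarith)
  have h2 : (|x| / N) ^ s ≤ (|y| / N) ^ s :=
    Real.rpow_le_rpow_of_nonpos hypos (by gcongr) hs0.le
  have h3 := h2.trans (hm.rpow_le hs hs0 hN (x := y) (by linarith))
  have hr : 0 < (|x| / N) ^ s := Real.rpow_pos_of_pos hxpos s
  rw [Real.rpow_neg hxpos.le, inv_pow, ← div_eq_mul_inv]
  rw [inv_le_comm₀ (mul_pos (hm.pos hs hN x) (hm.pos hs hN y)) (by positivity), inv_div]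
  rw [div_le_iff₀ (by norm_num), sq]
  calc _ ≤ (80 * m x) * (80 * m y) := mul_le_mul h1 h3 hr.le (hr.le.trans h1)
    _ = _ := by ring

lemma rpow_neg_le {s ρ : ℝ} (hs : -3 / 4 < s) (hs0 : s < 0) (hρ : 1 / 2 ≤ ρ) :
    ρ ^ (-s) ≤ 2 * ρ ^ (3 / 4 : ℝ) ∧ 1 ≤ 2 * ρ ^ (3 / 4 : ℝ) := by
  have hρpos : 0 < ρ := by linarith
  have h1 : 1 ≤ 2 * ρ ^ (3 / 4 : ℝ) := by
    have h2 : (1 / 2 : ℝ) ^ (1 : ℝ) ≤ (1 / 2 : ℝ) ^ (3 / 4 : ℝ) :=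
      Real.rpow_le_rpow_of_exponent_ge (by norm_num) (by norm_num) (by norm_num)
    have h3 : (1 / 2 : ℝ) ^ (3 / 4 : ℝ) ≤ ρ ^ (3 / 4 : ℝ) :=
      Real.rpow_le_rpow (by norm_num) hρ (by norm_num)
    rw [Real.rpow_one] at h2
    linarith
  refine ⟨?_, h1⟩
  rcases le_total 1 ρ with h | h
  · have : ρ ^ (-s) ≤ ρ ^ (3 / 4 : ℝ) := Real.rpow_le_rpow_of_exponent_le h (by linarith)
    linarith [Real.rpow_pos_of_pos hρpos (3 / 4)]
  · exact (Real.rpow_le_one hρpos.le h (by linarith)).trans h1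

/-- Three comparable frequencies: the output symbol cancels the loss of one input symbol, and the other
one, `(|x| / N) ^ (-s)`, is absorbed because `s > -3 / 4`. -/
lemma relSymbol_le_of_comparable (hm : IsSymbol s N m) (hs : -3 / 4 < s) (hs0 : s < 0)
    (hN : 1 ≤ N) {x y : ℝ} (hxN : N / 2 ≤ |x|) (hyx : |y| ≤ |x|) (hxy : |x| / 4 ≤ |y|)
    (hz : |x| / 4 ≤ |x + y|) : relSymbol m x y ≤ 600000 * (|x| / N) ^ (3 / 4 : ℝ) := by
  have hNpos : 0 < N := by linarith
  have hxpos : 0 < |x| / N := div_pos (by linarith) hNpos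
  have h1 := hm.relSymbol_le hs hN x y
  have h2 := hm.inv_mul_le hs hs0 hN hxN hyx hxy
  obtain ⟨h3, h4⟩ := rpow_neg_le hs hs0 (ρ := |x| / N) (by rw [le_div_iff₀ hNpos]; linarith)
  have h5 : m (x + y) ≤ 40 * (|x| / N) ^ s := by
    have h6 : (|x + y| / N) ^ s ≤ (1 / 4 * (|x| / N)) ^ s := by
      refine Real.rpow_le_rpow_of_nonpos (by positivity) ?_ hs0.le
      rw [← mul_div_assoc]
      gcongr
      linarith
    have h7 : (1 / 4 : ℝ) ^ s ≤ 4 := by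
      calc (1 / 4 : ℝ) ^ s ≤ (1 / 4 : ℝ) ^ (-1 : ℝ) :=
            Real.rpow_le_rpow_of_exponent_ge (by norm_num) (by norm_num) (by linarith)
        _ = 4 := by rw [Real.rpow_neg_one]; norm_num
    rw [Real.mul_rpow (by norm_num) hxpos.le] at h6
    have h8 : 0 < (|x| / N) ^ s := Real.rpow_pos_of_pos hxpos s
    have hz0 : x + y ≠ 0 := abs_pos.1 (by linarith)
    linarith [hm.le_rpow hs hs0 hN hz0, mul_le_mul_of_nonneg_right h7 h8.le]
  have h6 : m (x + y) / (m x * m y) ≤ 256000 * (|x| / N) ^ (-s) := by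
    rw [div_eq_mul_inv]
    calc _ ≤ 40 * (|x| / N) ^ s * (6400 * ((|x| / N) ^ (-s)) ^ 2) :=
          mul_le_mul h5 h2 (inv_nonneg.2 (mul_pos (hm.pos hs hN x) (hm.pos hs hN y)).le)
            ((hm.pos hs hN _).le.trans h5)
      _ = 256000 * ((|x| / N) ^ s * (|x| / N) ^ (-s)) * (|x| / N) ^ (-s) := by ring
      _ = _ := by
          rw [← Real.rpow_add hxpos, add_neg_cancel, Real.rpow_zero, mul_one]
  linarith

/-- Two comparable input frequencies; applied when their sum is much smaller. -/
lemma relSymbol_le_of_high_high (hm : IsSymbol s N m) (hs : -3 / 4 < s) (hs0 : s < 0)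
    (hN : 1 ≤ N) {x y : ℝ} (hxN : N / 2 ≤ |x|) (hyx : |y| ≤ |x|) (hxy : |x| / 4 ≤ |y|) :
    relSymbol m x y ≤ 30000 * (|x| / N) ^ (3 / 2 : ℝ) := by
  have hNpos : 0 < N := by linarith
  have hxpos : 0 < |x| / N := div_pos (by linarith) hNpos
  have h1 := hm.relSymbol_le hs hN x y
  have h2 := hm.inv_mul_le hs hs0 hN hxN hyx hxy
  obtain ⟨h3, h4⟩ := rpow_neg_le hs hs0 (ρ := |x| / N) (by rw [le_div_iff₀ hNpos]; linarith)
  have h5 : ((|x| / N) ^ (3 / 4 : ℝ)) ^ 2 = (|x| / N) ^ (3 / 2 : ℝ) := by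
    rw [← Real.rpow_mul_natCast hxpos.le]; norm_num
  have h6 : m (x + y) / (m x * m y) ≤ 25600 * (|x| / N) ^ (3 / 2 : ℝ) := by
    rw [div_eq_mul_inv]
    calc _ ≤ 1 * (6400 * ((|x| / N) ^ (-s)) ^ 2) := by
          gcongr
          · exact inv_nonneg.2 (mul_pos (hm.pos hs hN x) (hm.pos hs hN y)).le
          · exact hm.le_one hN _
      _ ≤ 1 * (6400 * (2 * (|x| / N) ^ (3 / 4 : ℝ)) ^ 2) := by gcongr
      _ = _ := by rw [mul_pow, h5]; ring
  have h7 : 1 ≤ 4 * (|x| / N) ^ (3 / 2 : ℝ) := by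
    rw [← h5]; nlinarith
  linarith

/-- The squared bounds, with the power `N^{-3/2}` factored out. -/
lemma sq_relSymbol_le (hm : IsSymbol s N m) (hs : -3 / 4 < s) (hs0 : s < 0)
    (hN : 1 ≤ N) {A : ℝ} (hA : ∀ ξ, |deriv m ξ| ≤ A / N) {x y : ℝ} (hxN : N / 2 ≤ |x|)
    (hyx : |y| ≤ |x|) :
    (|y| ≤ |x| / 4 ∧
      relSymbol m x y ^ 2 ≤ (600000 + 1600 * A) ^ 2 * N ^ (-3 / 2 : ℝ) * |y| ^ 2) ∨
    (|x| / 4 ≤ |y| ∧ |x| / 4 ≤ |x + y| ∧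
      relSymbol m x y ^ 2 ≤ (600000 + 1600 * A) ^ 2 * N ^ (-3 / 2 : ℝ) * (|x| * √|x|)) ∨
    (|x| / 4 ≤ |y| ∧ |x + y| ≤ |x| / 4 ∧
      relSymbol m x y ^ 2 ≤ (600000 + 1600 * A) ^ 2 * N ^ (-3 / 2 : ℝ) * |x| ^ 3) := by
  have hNpos : 0 < N := by linarith
  have hxpos : 0 < |x| := by linarith
  have hApos : 0 ≤ A := by
    have := (abs_nonneg _).trans (hA 0)
    by_contra h
    exact absurd this (not_le.2 (div_neg_of_neg_of_pos (not_le.1 h) hNpos))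
  have hM := hm.relSymbol_nonneg hs hN x y
  rcases le_total |y| (|x| / 4) with h | h
  · refine Or.inl ⟨h, ?_⟩
    have h1 := hm.relSymbol_le_of_separated hs hs0 hN hA hxN h
    have h2 : (N⁻¹) ^ 2 ≤ N ^ (-3 / 2 : ℝ) := by
      rw [inv_pow, ← Real.rpow_natCast, ← Real.rpow_neg hNpos.le]
      exact Real.rpow_le_rpow_of_exponent_le hN (by norm_num)
    calc relSymbol m x y ^ 2 ≤ ((600000 + 1600 * A) * (|y| / N)) ^ 2 := by
          gcongr
          exact h1.trans (by gcongr; norm_num)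
      _ = (600000 + 1600 * A) ^ 2 * (N⁻¹) ^ 2 * |y| ^ 2 := by ring
      _ ≤ _ := by gcongr
  rcases le_total (|x| / 4) |x + y| with hz | hz
  · refine Or.inr (Or.inl ⟨h, hz, ?_⟩)
    have h1 := hm.relSymbol_le_of_comparable hs hs0 hN hxN hyx h hz
    have h2 : ((|x| / N) ^ (3 / 4 : ℝ)) ^ 2 = N ^ (-3 / 2 : ℝ) * (|x| * √|x|) := by
      rw [← Real.rpow_mul_natCast (by positivity), Real.div_rpow hxpos.le hNpos.le,
        div_eq_inv_mul, ← Real.rpow_neg hNpos.le, Real.sqrt_eq_rpow,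
        ← Real.rpow_one_add' hxpos.le (by norm_num)]
      norm_num
    calc relSymbol m x y ^ 2 ≤ ((600000 + 1600 * A) * (|x| / N) ^ (3 / 4 : ℝ)) ^ 2 := by
          gcongr
          exact h1.trans (by gcongr; linarith)
      _ = _ := by rw [mul_pow, h2]; ring
  · refine Or.inr (Or.inr ⟨h, hz, ?_⟩)
    have h1 := hm.relSymbol_le_of_high_high hs hs0 hN hxN hyx h
    have h2 : ((|x| / N) ^ (3 / 2 : ℝ)) ^ 2 ≤ N ^ (-3 / 2 : ℝ) * |x| ^ 3 := by
      have h3 : N ^ (-3 : ℝ) ≤ N ^ (-3 / 2 : ℝ) :=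
        Real.rpow_le_rpow_of_exponent_le hN (by norm_num)
      calc ((|x| / N) ^ (3 / 2 : ℝ)) ^ 2 = N ^ (-3 : ℝ) * |x| ^ (3 : ℝ) := by
            rw [← Real.rpow_mul_natCast (by positivity), Real.div_rpow hxpos.le hNpos.le,
              div_eq_inv_mul, ← Real.rpow_neg hNpos.le]
            norm_num
        _ = N ^ (-3 : ℝ) * |x| ^ 3 := by rw [← Real.rpow_natCast]; norm_num
        _ ≤ _ := by gcongr
    calc relSymbol m x y ^ 2 ≤ ((600000 + 1600 * A) * (|x| / N) ^ (3 / 2 : ℝ)) ^ 2 := by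
          gcongr
          exact h1.trans (by gcongr; linarith)
      _ ≤ _ := by rw [mul_pow, mul_assoc]; gcongr

/-- The inequalities behind the two resonance estimates, in the case `|y| ≤ |x|`, for an arbitrary
size `K M²` of the squared symbol. Here `x + 2 y` and `2 x + y` are, up to sign, the differences
of the sum `x + y` with `-y` and `-x`. -/
lemma resonance_arith {K M x y : ℝ} (hK : 0 ≤ K) (hx : 1 / 2 ≤ |x|) (hyx : |y| ≤ |x|)
    (h : (|y| ≤ |x| / 4 ∧ M ≤ K * |y| ^ 2) ∨
      (|x| / 4 ≤ |y| ∧ |x| / 4 ≤ |x + y| ∧ M ≤ K * (|x| * √|x|)) ∨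
      (|x| / 4 ≤ |y| ∧ |x + y| ≤ |x| / 4 ∧ M ≤ K * |x| ^ 3)) :
    |x + y| * M ≤ 16 * K * (|x| * |y|) * (|x + y| * |x - y| + √|x + y|) ∧
    |x + y| * M ≤ 16 * K * (|x| * |y|) * (|x| * |x + 2 * y| + √|x|) ∧
    |x + y| * M ≤ 16 * K * (|x| * |y|) * (|y| * |y + 2 * x| + √|y|) := by
  have hD : |x| - |y| ≤ |x - y| := abs_sub_abs_le_abs_sub x y
  have hD' : 2 * |x| - |x + y| ≤ |x - y| := by
    have := abs_add_le (x + y) (x - y)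
    rw [show x + y + (x - y) = 2 * x by ring, abs_mul, abs_two] at this
    linarith
  have hE : |x| - 2 * |y| ≤ |x + 2 * y| := by
    have := abs_sub_abs_le_abs_sub x (-(2 * y))
    rwa [abs_neg, abs_mul, abs_two, sub_neg_eq_add] at this
  have hE' : |x| - 2 * |x + y| ≤ |x + 2 * y| := by
    have := abs_sub_abs_le_abs_sub x (2 * (x + y))
    rw [abs_mul, abs_two, ← abs_neg (x - _)] at this
    rwa [show -(x - 2 * (x + y)) = x + 2 * y by ring] at this
  have hF : 2 * |x| - |y| ≤ |y + 2 * x| := by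
    have := abs_sub_abs_le_abs_sub (2 * x) (-y)
    rwa [abs_neg, abs_mul, abs_two, sub_neg_eq_add, add_comm] at this
  have hF' : |x| - |x + y| ≤ |y + 2 * x| := by
    have := abs_sub_abs_le_abs_sub x (-(x + y))
    rwa [abs_neg, show x - -(x + y) = y + 2 * x by ring] at this
  have hE0 : 0 ≤ |x + 2 * y| := abs_nonneg _
  have hZ : |x + y| ≤ |x| + |y| := abs_add_le x y
  have hY0 : 0 ≤ |y| := abs_nonneg y
  have hZ0 : 0 ≤ |x + y| := abs_nonneg _
  generalize |x - y| = D at *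
  generalize |x + 2 * y| = E at *
  generalize |y + 2 * x| = F at *
  generalize |x| = X at *
  generalize |y| = Y at *
  generalize |x + y| = Z at *
  have hX0 : 0 ≤ X := by linarith
  have hD0 : 0 ≤ D := by linarith
  have drop₁ : ∀ {a b c d : ℝ}, 0 ≤ a → 0 ≤ b → 0 ≤ c → d ≤ a * b → d ≤ a * (b + c) := by
    intro a b c d ha hb hc h
    nlinarith [mul_nonneg ha hc]
  have drop₂ : ∀ {a b c d : ℝ}, 0 ≤ a → 0 ≤ b → 0 ≤ c → d ≤ a * c → d ≤ a * (b + c) := by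
    intro a b c d ha hb hc h
    nlinarith [mul_nonneg ha hb]
  have hcoef : 0 ≤ 16 * K * (X * Y) := by positivity
  rcases h with ⟨hY, hM⟩ | ⟨hY, hZX, hM⟩ | ⟨hY, hZX, hM⟩
  · have hE1 : X / 2 ≤ E := by linarith
    have hF0 : X ≤ F := by linarith
    have hD1 : X / 2 ≤ D := by linarith
    have hYX : Y ≤ X * X := by nlinarith
    have hZM : Z * M ≤ Z * (K * Y ^ 2) := by gcongr
    refine ⟨drop₁ hcoef (by positivity) (by positivity) ?_,
      drop₁ hcoef (mul_nonneg hX0 (by linarith)) (by positivity) ?_,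
      drop₁ hcoef (mul_nonneg hY0 (by linarith)) (by positivity) ?_⟩
    · calc Z * M ≤ K * Y * Z * Y := by linarith
        _ ≤ K * Y * Z * (X * X) := by gcongr
        _ ≤ K * Y * Z * (16 * (X * (X / 2))) := by
            have : 0 ≤ K * Y * Z * (X * X) := by positivity
            linarith
        _ ≤ K * Y * Z * (16 * (X * D)) := by gcongr
        _ = _ := by ring
    · calc Z * M ≤ K * Y * (Z * Y) := by linarith
        _ ≤ K * Y * ((2 * X) * (X * X)) := by gcongr; linarith
        _ ≤ K * Y * (16 * X * (X * (X / 2))) := by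
            have : 0 ≤ K * Y * (X * X * X) := by positivity
            linarith
        _ ≤ K * Y * (16 * X * (X * E)) := by gcongr
        _ = _ := by ring
    · calc Z * M ≤ K * Y ^ 2 * Z := by linarith
        _ ≤ K * Y ^ 2 * (16 * X * X) := by
            have : Z ≤ 16 * X * X := by nlinarith
            gcongr
        _ ≤ K * Y ^ 2 * (16 * X * F) := by gcongr
        _ = _ := by ring
  · have hZM : Z * M ≤ Z * (K * (X * √X)) := by gcongr
    have hXX : √X * √X = X := Real.mul_self_sqrt hX0
    have hZZ : √Z * √Z = Z := Real.mul_self_sqrt hZ0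
    have h4 : ∀ t : ℝ, √(4 * t) = 2 * √t := by
      intro t
      rw [Real.sqrt_mul (by norm_num), show (4 : ℝ) = 2 ^ 2 by norm_num,
        Real.sqrt_sq (by norm_num)]
    have hsZ : √Z ≤ 2 * √X := by
      rw [← h4]; exact Real.sqrt_le_sqrt (by linarith)
    have hsX : √X ≤ 2 * √Y := by
      rw [← h4]; exact Real.sqrt_le_sqrt (by linarith)
    refine ⟨drop₂ hcoef (by positivity) (by positivity) ?_,
      drop₂ hcoef (mul_nonneg hX0 ?_) (by positivity) ?_,
      drop₂ hcoef (mul_nonneg hY0 ?_) (by positivity) ?_⟩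
    · calc Z * M ≤ √Z * √Z * (K * (X * √X)) := by rwa [hZZ]
        _ ≤ √Z * (2 * √X) * (K * (X * √X)) := by gcongr
        _ = 2 * K * (X * (√X * √X)) * √Z := by ring
        _ = 2 * K * (X * X) * √Z := by rw [hXX]
        _ ≤ 16 * K * (X * (X / 4)) * √Z := by
            have : 0 ≤ K * (X * X) * √Z := by positivity
            linarith
        _ ≤ _ := by gcongr
    · exact hE0
    · calc Z * M ≤ (2 * X) * (K * (X * √X)) := by
            refine hZM.trans ?_
            gcongr
            linarith
        _ ≤ 16 * K * (X * (X / 4)) * √X := by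
            have : 0 ≤ K * (X * X) * √X := by positivity
            linarith
        _ ≤ _ := by gcongr
    · linarith
    · calc Z * M ≤ (2 * X) * (K * (X * √X)) := by
            refine hZM.trans ?_
            gcongr
            linarith
        _ ≤ (2 * X) * (K * (X * (2 * √Y))) := by gcongr
        _ = 16 * K * (X * (X / 4)) * √Y := by ring
        _ ≤ _ := by gcongr
  · have hZM : Z * M ≤ Z * (K * X ^ 3) := by gcongr
    have hE1 : X / 2 ≤ E := by linarith
    have hF0 : X / 2 ≤ F := by linarith
    have hD1 : X ≤ D := by linarith
    refine ⟨drop₁ hcoef (by positivity) (by positivity) ?_,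
      drop₁ hcoef (mul_nonneg hX0 (by linarith)) (by positivity) ?_,
      drop₁ hcoef (mul_nonneg hY0 (by linarith)) (by positivity) ?_⟩
    · calc Z * M ≤ Z * (K * X ^ 3) := hZM
        _ ≤ 16 * K * (X * (X / 4)) * (Z * X) := by
            have : 0 ≤ Z * (K * X ^ 3) := by positivity
            linarith
        _ ≤ _ := by gcongr
    · calc Z * M ≤ X / 4 * (K * X ^ 3) := hZM.trans (by gcongr)
        _ ≤ 16 * K * (X * (X / 4)) * (X * (X / 2)) := by
            have : 0 ≤ X * (K * X ^ 3) := by positivity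
            linarith
        _ ≤ _ := by gcongr
    · calc Z * M ≤ X / 4 * (K * X ^ 3) := hZM.trans (by gcongr)
        _ ≤ 16 * K * (X * (X / 4)) * (X / 4 * (X / 2)) := by
            have : 0 ≤ X * (K * X ^ 3) := by positivity
            linarith
        _ ≤ _ := by gcongr

/-- The bound on the commutator symbol when the output modulation is the largest: the factor on the
right is a third of the derivative of the resonance function in the frequency variable `x` with `x + y`
fixed, corrected by `√|x + y|` at its critical point. -/
lemma output_bound (hm : IsSymbol s N m) (hs : -3 / 4 < s) (hs0 : s < 0)
    (hN : 1 ≤ N) {A : ℝ} (hA : ∀ ξ, |deriv m ξ| ≤ A / N) (x y : ℝ) :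
    |x + y| * relSymbol m x y ^ 2 ≤ 16 * ((600000 + 1600 * A) ^ 2 * N ^ (-3 / 2 : ℝ)) *
      (|x| * |y|) * (|x + y| * |x - y| + √|x + y|) := by
  have hN0 : 0 < N := by linarith
  wlog hyx : |y| ≤ |x| generalizing x y
  · have := this y x (le_of_not_ge hyx)
    rwa [relSymbol_comm, add_comm y x, abs_sub_comm, mul_comm |y|] at this
  rcases lt_or_ge |x| (N / 2) with h | h
  · rw [hm.relSymbol_eq_zero h hyx]; simp; positivity
  · exact (resonance_arith (by positivity) (by linarith) hyx
      (hm.sq_relSymbol_le hs hs0 hN hA h hyx)).1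

/-- The bound on the commutator symbol when the modulation at frequency `x` is the largest. -/
lemma input_bound (hm : IsSymbol s N m) (hs : -3 / 4 < s) (hs0 : s < 0)
    (hN : 1 ≤ N) {A : ℝ} (hA : ∀ ξ, |deriv m ξ| ≤ A / N) (x y : ℝ) :
    |x + y| * relSymbol m x y ^ 2 ≤ 16 * ((600000 + 1600 * A) ^ 2 * N ^ (-3 / 2 : ℝ)) *
      (|x| * |y|) * (|x| * |x + 2 * y| + √|x|) := by
  have hN0 : 0 < N := by linarith
  rcases le_total |y| |x| with hyx | hyx
  · rcases lt_or_ge |x| (N / 2) with h | h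
    · rw [hm.relSymbol_eq_zero h hyx]; simp; positivity
    · exact (resonance_arith (by positivity) (by linarith) hyx
        (hm.sq_relSymbol_le hs hs0 hN hA h hyx)).2.1
  · rw [relSymbol_comm, add_comm x y, mul_comm |x| |y|]
    rcases lt_or_ge |y| (N / 2) with h | h
    · rw [hm.relSymbol_eq_zero h hyx]; simp; positivity
    · exact (resonance_arith (by positivity) (by linarith) hyx
        (hm.sq_relSymbol_le hs hs0 hN hA h hyx)).2.2

end IsSymbol

/-! ### The weighted bilinear estimate -/

/-- The signed distance `τ - ξ³` of a frequency `(τ, ξ)` to the characteristic cubic. -/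
def modulation (p : ℝ × ℝ) : ℝ := p.1 - p.2 ^ 3

@[fun_prop]
lemma measurable_modulation : Measurable modulation := by unfold modulation; fun_prop

/-- The resonance identity: one of the three modulations controls the product of the three spatial
frequencies. -/
lemma abs_mul_le_modulation (p q : ℝ × ℝ) :
    |p.2| * (|q.2| * |(p - q).2|) ≤ |modulation p| ∨
    |p.2| * (|q.2| * |(p - q).2|) ≤ |modulation q| ∨
    |p.2| * (|q.2| * |(p - q).2|) ≤ |modulation (p - q)| := by
  have key : modulation p - modulation q - modulation (p - q) =
      -(3 * (p.2 * (q.2 * (p - q).2))) := by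
    simp only [modulation, Prod.fst_sub, Prod.snd_sub]; ring
  have h : 3 * (|p.2| * (|q.2| * |(p - q).2|)) ≤
      |modulation p| + |modulation q| + |modulation (p - q)| := by
    calc _ = |modulation p - modulation q - modulation (p - q)| := by
          rw [key, abs_neg, abs_mul, abs_mul, abs_mul]; norm_num
      _ ≤ _ := (abs_sub _ _).trans (by gcongr; exact abs_sub _ _)
  by_contra! hc
  linarith [hc.1, hc.2.1, hc.2.2]

/-- The constant in the uniform bound of the kernel, apart from the size of the symbol. -/
noncomputable def kernelConst (δ : ℝ) : ℝ≥0∞ :=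
  ENNReal.ofReal (2 ^ (1 + δ)) * (2 * decayMass δ) * (2 * decayMass δ + 2)

lemma kernelConst_lt_top {δ : ℝ} (hδ : 0 < δ) : kernelConst δ < ⊤ := by
  have := decayMass_lt_top hδ
  unfold kernelConst
  finiteness

/-- Integration in time frequency leaves a decaying function of the resonance function, which is
quadratic in the spatial frequency. -/
lemma lintegral_quadratic_resonance_le {δ : ℝ} (hδ : 0 < δ) {α β : ℝ → ℝ} (hα : Measurable α)
    (hβ : Measurable β) {a c y₀ : ℝ} (h : ∀ y, β y - α y = a - c * (y - y₀) ^ 2) :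
    ∫⁻ q : ℝ × ℝ, ENNReal.ofReal (|c| * |q.2 - y₀| + √|c|) *
      (decayWeight δ (q.1 - α q.2) * decayWeight δ (β q.2 - q.1)) ≤ kernelConst δ := by
  rw [Measure.volume_eq_prod, lintegral_prod_symm _ (by fun_prop)]
  calc _ ≤ ∫⁻ y, ENNReal.ofReal (2 ^ (1 + δ)) * (2 * decayMass δ) *
        (ENNReal.ofReal (|c| * |y - y₀| + √|c|) * decayWeight δ (a - c * (y - y₀) ^ 2)) := by
        apply lintegral_mono
        intro y
        simp only
        rw [lintegral_const_mul _ (by fun_prop), ← h y]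
        calc _ ≤ _ := mul_le_mul_right (lintegral_decayWeight_mul_le hδ (α y) (β y)) _
          _ = _ := by ring
    _ ≤ _ := by
        rw [lintegral_const_mul _ (by fun_prop)]
        exact mul_le_mul_right (lintegral_quadratic_decayWeight_le hδ a c y₀) _

lemma sq_mul_rpow_neg_le {δ z M B X J σ : ℝ} (hδ : 0 < δ) (hBJ : 0 ≤ B * J)
    (h : |z| * M ^ 2 ≤ B * X * J) (hσ : |z| * X ≤ |σ|) :
    (|z| * M) ^ 2 * (1 + |σ|) ^ (-(1 + δ)) ≤ B * J := by
  have h1 : (1 + |σ|) ^ (-(1 + δ)) ≤ (1 + |σ|)⁻¹ := by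
    rw [← Real.rpow_neg_one]
    exact Real.rpow_le_rpow_of_exponent_le (by linarith [abs_nonneg σ]) (by linarith)
  calc _ ≤ (|z| * M) ^ 2 * (1 + |σ|)⁻¹ := by gcongr
    _ = |z| * (|z| * M ^ 2) * (1 + |σ|)⁻¹ := by ring
    _ ≤ |z| * (B * X * J) * (1 + |σ|)⁻¹ := by gcongr
    _ = (|z| * X) * (B * J) * (1 + |σ|)⁻¹ := by ring
    _ ≤ (1 + |σ|) * (B * J) * (1 + |σ|)⁻¹ := by gcongr; linarith
    _ = B * J := by field_simp

/-- The square root of `decayWeight δ` of the modulation. -/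
noncomputable def halfWeight (δ : ℝ) (p : ℝ × ℝ) : ℝ≥0∞ :=
  ENNReal.ofReal ((1 + |modulation p|) ^ (-(1 + δ) / 2))

@[fun_prop]
lemma measurable_halfWeight (δ : ℝ) : Measurable (halfWeight δ) := by
  unfold halfWeight; fun_prop

lemma halfWeight_sq (δ : ℝ) (p : ℝ × ℝ) :
    halfWeight δ p ^ 2 = decayWeight δ (modulation p) := by
  unfold halfWeight decayWeight
  rw [← ENNReal.ofReal_pow (by positivity), ← Real.rpow_mul_natCast (by positivity)]
  norm_num

lemma mul_halfWeight_mul (δ : ℝ) (p : ℝ × ℝ) (a : ℝ≥0∞) :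
    halfWeight δ p * (a * ENNReal.ofReal ((1 + |modulation p|) ^ ((1 + δ) / 2))) = a := by
  unfold halfWeight
  rw [mul_left_comm, ← ENNReal.ofReal_mul (by positivity), ← Real.rpow_add (by positivity)]
  rw [neg_div, neg_add_cancel, Real.rpow_zero, ENNReal.ofReal_one, mul_one]

/-- The kernel of the bilinear operator acting on the weighted transforms of `I u` and `I v`. -/
noncomputable def commKernel (δ : ℝ) (m : ℝ → ℝ) (p q : ℝ × ℝ) : ℝ≥0∞ :=
  ENNReal.ofReal (|p.2| * relSymbol m q.2 (p - q).2) *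
    (halfWeight δ p * (halfWeight δ q * halfWeight δ (p - q)))

lemma commKernel_sub (δ : ℝ) (m : ℝ → ℝ) (p q : ℝ × ℝ) :
    commKernel δ m p (p - q) = commKernel δ m p q := by
  unfold commKernel
  rw [sub_sub_cancel, relSymbol_comm, mul_comm (halfWeight δ (p - q))]

lemma measurable_relSymbol {m : ℝ → ℝ} (hm : Measurable m) :
    Measurable (fun z : ℝ × ℝ => relSymbol m z.1 z.2) := by
  unfold relSymbol; fun_prop

lemma measurable_commKernel (δ : ℝ) {m : ℝ → ℝ} (hm : Measurable m) :
    Measurable (Function.uncurry (commKernel δ m)) := by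
  have h : Measurable (fun z : (ℝ × ℝ) × (ℝ × ℝ) => relSymbol m z.2.2 (z.1 - z.2).2) :=
    (measurable_relSymbol hm).comp (g := fun z : ℝ × ℝ => relSymbol m z.1 z.2)
      (f := fun z : (ℝ × ℝ) × (ℝ × ℝ) => (z.2.2, (z.1 - z.2).2)) (by fun_prop)
  unfold Function.uncurry commKernel
  fun_prop

section Estimate

variable {s N A δ : ℝ} {m : ℝ → ℝ}

lemma IsSymbol.commKernel_sq (hm : IsSymbol s N m) (hs : -3 / 4 < s) (hN : 1 ≤ N)
    (p q : ℝ × ℝ) :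
    commKernel δ m p q ^ 2 = ENNReal.ofReal ((|p.2| * relSymbol m q.2 (p - q).2) ^ 2) *
      (decayWeight δ (modulation p) *
        (decayWeight δ (modulation q) * decayWeight δ (modulation (p - q)))) := by
  unfold commKernel
  rw [mul_pow, mul_pow, mul_pow, halfWeight_sq, halfWeight_sq, halfWeight_sq, ENNReal.ofReal_pow]
  exact mul_nonneg (abs_nonneg _) (hm.relSymbol_nonneg hs hN _ _)

/-- The factor `N^{-3/2}` with the constant of the symbol bounds. -/
noncomputable def symbolConst (A N : ℝ) : ℝ :=
  16 * ((600000 + 1600 * A) ^ 2 * N ^ (-3 / 2 : ℝ))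

lemma symbolConst_nonneg (hN : 1 ≤ N) : 0 ≤ symbolConst A N := by
  unfold symbolConst; positivity

/-- Region where the output modulation is the largest, with the output frequency fixed. -/
lemma lintegral_commKernel_output_le (hm : IsSymbol s N m) (hs : -3 / 4 < s) (hs0 : s < 0)
    (hN : 1 ≤ N) (hA : ∀ ξ, |deriv m ξ| ≤ A / N) (hδ : 0 < δ) (p : ℝ × ℝ) :
    ∫⁻ q, ({q | |p.2| * (|q.2| * |(p - q).2|) ≤ |modulation p|}.indicator
      (commKernel δ m p) q) ^ 2 ≤ ENNReal.ofReal (symbolConst A N) * kernelConst δ := by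
  have hB := symbolConst_nonneg (A := A) hN
  refine le_trans ?_ (mul_le_mul_right (lintegral_quadratic_resonance_le hδ
    (α := fun y => y ^ 3) (β := fun y => p.1 - (p.2 - y) ^ 3) (a := p.1 - p.2 ^ 3 / 4)
    (c := 3 * p.2) (y₀ := p.2 / 2) (by fun_prop) (by fun_prop) (fun y => by ring)) _)
  rw [← lintegral_const_mul _ (by fun_prop)]
  apply lintegral_mono
  intro q
  by_cases hq : q ∈ {q | |p.2| * (|q.2| * |(p - q).2|) ≤ |modulation p|}
  swap
  · simp only [Set.indicator_of_notMem hq]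
    simp
  simp only [Set.indicator_of_mem hq]
  have hb := hm.output_bound hs hs0 hN hA q.2 (p - q).2
  rw [show q.2 + (p - q).2 = p.2 by simp] at hb
  have hb' := sq_mul_rpow_neg_le (δ := δ) (M := relSymbol m q.2 (p - q).2)
    (B := symbolConst A N)
    (J := |p.2| * |q.2 - (p - q).2| + √|p.2|) hδ (by positivity)
    hb hq
  have hJ : |p.2| * |q.2 - (p - q).2| + √|p.2| ≤
      |3 * p.2| * |q.2 - p.2 / 2| + √|3 * p.2| := by
    have h1 : |q.2 - (p - q).2| = 2 * |q.2 - p.2 / 2| := by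
      rw [← abs_two, ← abs_mul, Prod.snd_sub]; congr 1; simp; ring
    rw [h1, abs_mul, abs_of_pos (by norm_num : (0 : ℝ) < 3)]
    have h2 : √|p.2| ≤ √(3 * |p.2|) := Real.sqrt_le_sqrt (by linarith [abs_nonneg p.2])
    nlinarith [mul_nonneg (abs_nonneg p.2) (abs_nonneg (q.2 - p.2 / 2))]
  calc commKernel δ m p q ^ 2 =
      ENNReal.ofReal ((|p.2| * relSymbol m q.2 (p - q).2) ^ 2 *
          (1 + |modulation p|) ^ (-(1 + δ))) *
        (decayWeight δ (modulation q) * decayWeight δ (modulation (p - q))) := by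
        rw [hm.commKernel_sq hs hN, ENNReal.ofReal_mul (by positivity), ← decayWeight]
        ring
    _ ≤ ENNReal.ofReal (symbolConst A N * (|3 * p.2| * |q.2 - p.2 / 2| + √|3 * p.2|)) *
        (decayWeight δ (modulation q) * decayWeight δ (modulation (p - q))) :=
        mul_le_mul_left
          (ENNReal.ofReal_le_ofReal (hb'.trans (mul_le_mul_of_nonneg_left hJ hB))) _
    _ = _ := by
        rw [ENNReal.ofReal_mul hB, mul_assoc]
        simp only [modulation, Prod.fst_sub, Prod.snd_sub]
        rw [show p.1 - q.1 - (p.2 - q.2) ^ 3 = p.1 - (p.2 - q.2) ^ 3 - q.1 by ring]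

/-- Region where one input modulation is the largest, with the frequency of that input fixed. -/
lemma lintegral_commKernel_input_le (hm : IsSymbol s N m) (hs : -3 / 4 < s) (hs0 : s < 0)
    (hN : 1 ≤ N) (hA : ∀ ξ, |deriv m ξ| ≤ A / N) (hδ : 0 < δ) (q : ℝ × ℝ) :
    ∫⁻ p, ({p | |p.2| * (|q.2| * |(p - q).2|) ≤ |modulation q|}.indicator
      (fun p => commKernel δ m p q) p) ^ 2 ≤
        ENNReal.ofReal (symbolConst A N) * kernelConst δ := by
  have hB := symbolConst_nonneg (A := A) hN
  refine le_trans ?_ (mul_le_mul_right (lintegral_quadratic_resonance_le hδ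
    (α := fun y => y ^ 3) (β := fun y => q.1 + (y - q.2) ^ 3) (a := q.1 - q.2 ^ 3 / 4)
    (c := 3 * q.2) (y₀ := q.2 / 2) (by fun_prop) (by fun_prop) (fun y => by ring)) _)
  rw [← lintegral_const_mul _ (by fun_prop)]
  apply lintegral_mono
  intro p
  by_cases hp : p ∈ {p | |p.2| * (|q.2| * |(p - q).2|) ≤ |modulation q|}
  swap
  · simp only [Set.indicator_of_notMem hp]
    simp
  simp only [Set.indicator_of_mem hp]
  have hb := hm.input_bound hs hs0 hN hA q.2 (p - q).2
  rw [show q.2 + (p - q).2 = p.2 by simp] at hb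
  have hb' := sq_mul_rpow_neg_le (δ := δ) (M := relSymbol m q.2 (p - q).2)
    (B := symbolConst A N)
    (J := |q.2| * |q.2 + 2 * (p - q).2| + √|q.2|) hδ (by positivity)
    hb hp
  have hJ : |q.2| * |q.2 + 2 * (p - q).2| + √|q.2| ≤
      |3 * q.2| * |p.2 - q.2 / 2| + √|3 * q.2| := by
    have h1 : |q.2 + 2 * (p - q).2| = 2 * |p.2 - q.2 / 2| := by
      rw [← abs_two, ← abs_mul, Prod.snd_sub]; congr 1; simp; ring
    rw [h1, abs_mul, abs_of_pos (by norm_num : (0 : ℝ) < 3)]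
    have h2 : √|q.2| ≤ √(3 * |q.2|) := Real.sqrt_le_sqrt (by linarith [abs_nonneg q.2])
    nlinarith [mul_nonneg (abs_nonneg q.2) (abs_nonneg (p.2 - q.2 / 2))]
  calc commKernel δ m p q ^ 2 =
      ENNReal.ofReal ((|p.2| * relSymbol m q.2 (p - q).2) ^ 2 *
          (1 + |modulation q|) ^ (-(1 + δ))) *
        (decayWeight δ (modulation p) * decayWeight δ (modulation (p - q))) := by
        rw [hm.commKernel_sq hs hN, ENNReal.ofReal_mul (by positivity), ← decayWeight]
        ring
    _ ≤ ENNReal.ofReal (symbolConst A N * (|3 * q.2| * |p.2 - q.2 / 2| + √|3 * q.2|)) *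
        (decayWeight δ (modulation p) * decayWeight δ (modulation (p - q))) :=
        mul_le_mul_left
          (ENNReal.ofReal_le_ofReal (hb'.trans (mul_le_mul_of_nonneg_left hJ hB))) _
    _ = _ := by
        rw [ENNReal.ofReal_mul hB, mul_assoc, ← decayWeight_neg δ (modulation (p - q))]
        simp only [modulation, Prod.fst_sub, Prod.snd_sub]
        rw [show -(p.1 - q.1 - (p.2 - q.2) ^ 3) = q.1 + (p.2 - q.2) ^ 3 - p.1 by ring]

/-- The bilinear operator dominating the transform of the commutator, apart from the factor `ξ`
of the derivative. -/
noncomputable def dominantConv (m : ℝ → ℝ) (f g : ℝ × ℝ → ℝ≥0∞) (p : ℝ × ℝ) : ℝ≥0∞ :=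
  ∫⁻ q, ENNReal.ofReal (relSymbol m q.2 (p - q).2) * (f q * g (p - q))

lemma lintegral_sq_dominantConv_le_of_measurable (hm : IsSymbol s N m) (hs : -3 / 4 < s)
    (hs0 : s < 0) (hN : 1 ≤ N) (hA : ∀ ξ, |deriv m ξ| ≤ A / N) (hδ : 0 < δ)
    {f g : ℝ × ℝ → ℝ≥0∞} (hf : Measurable f) (hg : Measurable g) :
    ∫⁻ p, (ENNReal.ofReal |p.2| * dominantConv m f g p) ^ 2 *
        decayWeight δ (modulation p) ≤
      9 * (ENNReal.ofReal (symbolConst A N) * kernelConst δ *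
        ((∫⁻ q, f q ^ 2 * ENNReal.ofReal ((1 + |modulation q|) ^ (1 + δ))) *
          ∫⁻ q, g q ^ 2 * ENNReal.ofReal ((1 + |modulation q|) ^ (1 + δ)))) := by
  have hmm : Measurable m := hm.smooth.continuous.measurable
  have hk := measurable_commKernel δ hmm
  set F : ℝ × ℝ → ℝ≥0∞ := fun q =>
    f q * ENNReal.ofReal ((1 + |modulation q|) ^ ((1 + δ) / 2)) with hF
  set G : ℝ × ℝ → ℝ≥0∞ := fun q =>
    g q * ENNReal.ofReal ((1 + |modulation q|) ^ ((1 + δ) / 2)) with hG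
  have hFm : Measurable F := by fun_prop
  have hGm : Measurable G := by fun_prop
  have hsq : ∀ (a : ℝ≥0∞) (q : ℝ × ℝ),
      (a * ENNReal.ofReal ((1 + |modulation q|) ^ ((1 + δ) / 2))) ^ 2 =
        a ^ 2 * ENNReal.ofReal ((1 + |modulation q|) ^ (1 + δ)) := by
    intro a q
    rw [mul_pow, ← ENNReal.ofReal_pow (by positivity), ← Real.rpow_mul_natCast (by positivity)]
    norm_num
  have hrew : ∀ p, (ENNReal.ofReal |p.2| * dominantConv m f g p) ^ 2 *
      decayWeight δ (modulation p) = (∫⁻ q, commKernel δ m p q * (F q * G (p - q))) ^ 2 := by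
    intro p
    have h1 : ∀ q, commKernel δ m p q * (F q * G (p - q)) =
        ENNReal.ofReal |p.2| * halfWeight δ p *
          (ENNReal.ofReal (relSymbol m q.2 (p - q).2) * (f q * g (p - q))) := by
      intro q
      rw [commKernel, ENNReal.ofReal_mul (abs_nonneg _)]
      calc _ = ENNReal.ofReal |p.2| * halfWeight δ p *
            (ENNReal.ofReal (relSymbol m q.2 (p - q).2) *
              ((halfWeight δ q * F q) * (halfWeight δ (p - q) * G (p - q)))) := by ring
        _ = _ := by rw [hF, hG, mul_halfWeight_mul, mul_halfWeight_mul]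
    simp_rw [h1]
    rw [lintegral_const_mul' _ _ (by unfold halfWeight; finiteness), ← halfWeight_sq,
      dominantConv]
    ring
  simp_rw [hrew]
  have hmain := lintegral_sq_convolution_le (μ := (volume : Measure (ℝ × ℝ))) hFm hGm hk
    (k₀ := fun p q => {q | |p.2| * (|q.2| * |(p - q).2|) ≤ |modulation p|}.indicator
      (commKernel δ m p) q)
    (k₁ := fun p q => {p | |p.2| * (|q.2| * |(p - q).2|) ≤ |modulation q|}.indicator
      (fun p => commKernel δ m p q) p)
    (k₂ := fun p q => {q | |p.2| * (|q.2| * |(p - q).2|) ≤ |modulation (p - q)|}.indicator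
      (commKernel δ m p) q)
    (S := ENNReal.ofReal (symbolConst A N) * kernelConst δ)
    (hk.indicator (s := {z : (ℝ × ℝ) × (ℝ × ℝ) |
        |z.1.2| * (|z.2.2| * |(z.1 - z.2).2|) ≤ |modulation z.1|})
      (measurableSet_le (by fun_prop) (by fun_prop)))
    (hk.indicator (s := {z : (ℝ × ℝ) × (ℝ × ℝ) |
        |z.1.2| * (|z.2.2| * |(z.1 - z.2).2|) ≤ |modulation z.2|})
      (measurableSet_le (by fun_prop) (by fun_prop)))
    (hk.indicator (s := {z : (ℝ × ℝ) × (ℝ × ℝ) |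
        |z.1.2| * (|z.2.2| * |(z.1 - z.2).2|) ≤ |modulation (z.1 - z.2)|})
      (measurableSet_le (by fun_prop) (by fun_prop))) ?_
    (fun p => lintegral_commKernel_output_le hm hs hs0 hN hA hδ p)
    (fun q => lintegral_commKernel_input_le hm hs hs0 hN hA hδ q) ?_
  · simpa only [hF, hG, hsq] using hmain
  · intro p q
    simp only [Set.indicator, Set.mem_ofPred_eq]
    rcases abs_mul_le_modulation p q with h | h | h
    · rw [if_pos h, add_assoc]; exact le_self_add
    · rw [if_pos h, add_right_comm]; exact le_add_self
    · rw [if_pos h]; exact le_add_self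
  · intro q
    refine le_trans (le_of_eq ?_) (lintegral_commKernel_input_le hm hs hs0 hN hA hδ q)
    congr 1 with p
    simp only [Set.indicator, Set.mem_ofPred_eq, sub_sub_cancel, commKernel_sub,
      mul_comm |(p - q).2|]

lemma dominantConv_mk (m : ℝ → ℝ) {f g : ℝ × ℝ → ℝ≥0∞} (hf : AEMeasurable f)
    (hg : AEMeasurable g) : dominantConv m f g = dominantConv m (hf.mk f) (hg.mk g) := by
  ext p
  apply lintegral_congr_ae
  have h1 : ∀ᵐ q, g (p - q) = hg.mk g (p - q) :=
    (Measure.measurePreserving_sub_left volume p).quasiMeasurePreserving.ae hg.ae_eq_mk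
  filter_upwards [hf.ae_eq_mk, h1] with q h2 h3
  rw [h2, h3]

lemma measurable_dominantConv {m : ℝ → ℝ} (hm : Measurable m) {f g : ℝ × ℝ → ℝ≥0∞}
    (hf : AEMeasurable f) (hg : AEMeasurable g) : Measurable (dominantConv m f g) := by
  rw [dominantConv_mk m hf hg]
  have h : Measurable (fun z : (ℝ × ℝ) × (ℝ × ℝ) => relSymbol m z.2.2 (z.1 - z.2).2) :=
    (measurable_relSymbol hm).comp (g := fun z : ℝ × ℝ => relSymbol m z.1 z.2)
      (f := fun z : (ℝ × ℝ) × (ℝ × ℝ) => (z.2.2, (z.1 - z.2).2)) (by fun_prop)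
  have hf' := hf.measurable_mk
  have hg' := hg.measurable_mk
  exact Measurable.lintegral_prod_right' (f := fun z : (ℝ × ℝ) × (ℝ × ℝ) =>
    ENNReal.ofReal (relSymbol m z.2.2 (z.1 - z.2).2) * (hf.mk f z.2 * hg.mk g (z.1 - z.2)))
    (by fun_prop)

/-- The weighted bilinear estimate. -/
theorem lintegral_sq_dominantConv_le (hm : IsSymbol s N m) (hs : -3 / 4 < s)
    (hs0 : s < 0) (hN : 1 ≤ N) (hA : ∀ ξ, |deriv m ξ| ≤ A / N) (hδ : 0 < δ)
    {f g : ℝ × ℝ → ℝ≥0∞} (hf : AEMeasurable f) (hg : AEMeasurable g) :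
    ∫⁻ p, (ENNReal.ofReal |p.2| * dominantConv m f g p) ^ 2 *
        decayWeight δ (modulation p) ≤
      9 * (ENNReal.ofReal (symbolConst A N) * kernelConst δ *
        ((∫⁻ q, f q ^ 2 * ENNReal.ofReal ((1 + |modulation q|) ^ (1 + δ))) *
          ∫⁻ q, g q ^ 2 * ENNReal.ofReal ((1 + |modulation q|) ^ (1 + δ)))) := by
  have hL2 : ∀ {f : ℝ × ℝ → ℝ≥0∞} (hf : AEMeasurable f),
      ∫⁻ q, f q ^ 2 * ENNReal.ofReal ((1 + |modulation q|) ^ (1 + δ)) =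
        ∫⁻ q, hf.mk f q ^ 2 * ENNReal.ofReal ((1 + |modulation q|) ^ (1 + δ)) := by
    intro f hf
    apply lintegral_congr_ae
    filter_upwards [hf.ae_eq_mk] with q h
    rw [h]
  rw [dominantConv_mk m hf hg, hL2 hf, hL2 hg]
  exact lintegral_sq_dominantConv_le_of_measurable hm hs hs0 hN hA hδ
    hf.measurable_mk hg.measurable_mk

/-! ### The estimate in terms of spacetime Fourier transforms -/

lemma spectralNorm_zero_sq (b : ℝ) (F : ℝ × ℝ → ℂ) :
    spectralNorm 0 b F ^ 2 =
      ∫⁻ p, ‖F p‖ₑ ^ 2 * ENNReal.ofReal ((1 + |modulation p|) ^ (2 * b)) := by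
  unfold spectralNorm modulation
  rw [← ENNReal.rpow_mul_natCast]
  simp

lemma lintegral_sq_mul_le_spectralNorm {δ b : ℝ} (hb : 1 + δ ≤ 2 * b) (F : ℝ × ℝ → ℂ) :
    ∫⁻ p, ‖F p‖ₑ ^ 2 * ENNReal.ofReal ((1 + |modulation p|) ^ (1 + δ)) ≤
      spectralNorm 0 b F ^ 2 := by
  rw [spectralNorm_zero_sq]
  gcongr
  linarith [abs_nonneg (modulation ‹_›)]

lemma spectralNorm_sq_le_lintegral {δ b : ℝ} (hb : 2 * b ≤ -(1 + δ)) (F : ℝ × ℝ → ℂ) :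
    spectralNorm 0 b F ^ 2 ≤ ∫⁻ p, ‖F p‖ₑ ^ 2 * decayWeight δ (modulation p) := by
  rw [spectralNorm_zero_sq]
  unfold decayWeight
  gcongr
  linarith [abs_nonneg (modulation ‹_›)]

/-- The transform of `I u` in absolute value. -/
noncomputable def absSpectrum (m : ℝ → ℝ) (U : ℝ × ℝ → ℂ) (p : ℝ × ℝ) : ℝ≥0∞ :=
  ‖multiplierSpectrum m U p‖ₑ

lemma IsSymbol.aestronglyMeasurable_multiplierSpectrum (hm : IsSymbol s N m) {U : ℝ × ℝ → ℂ}
    (hU : AEStronglyMeasurable U) : AEStronglyMeasurable (multiplierSpectrum m U) := by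
  have hmc := hm.smooth.continuous
  have : Continuous (fun p : ℝ × ℝ => (m p.2 : ℂ)) := by fun_prop
  exact this.aestronglyMeasurable.mul hU

lemma IsSymbol.aemeasurable_absSpectrum (hm : IsSymbol s N m) {U : ℝ × ℝ → ℂ}
    (hU : AEStronglyMeasurable U) : AEMeasurable (absSpectrum m U) :=
  (hm.aestronglyMeasurable_multiplierSpectrum hU).enorm

lemma aestronglyMeasurable_comp_sub_left {V : ℝ × ℝ → ℂ} (hV : AEStronglyMeasurable V)
    (p : ℝ × ℝ) : AEStronglyMeasurable (fun q => V (p - q)) :=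
  hV.comp_quasiMeasurePreserving
    (Measure.measurePreserving_sub_left volume p).quasiMeasurePreserving

lemma enorm_ofReal_mul {a : ℝ} (ha : 0 ≤ a) (z : ℂ) : ‖(a : ℂ) * z‖ₑ = ENNReal.ofReal a * ‖z‖ₑ := by
  rw [enorm_mul, ← ofReal_norm (a : ℂ), Complex.norm_real, Real.norm_of_nonneg ha]

/-- The product of the transforms of `I u` and `I v` converges absolutely, at every frequency. -/
lemma lintegral_absSpectrum_mul_lt_top (hm : IsSymbol s N m) (hδ : 0 < δ) {U V : ℝ × ℝ → ℂ}
    (hU : AEStronglyMeasurable U) (hV : AEStronglyMeasurable V)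
    (hUf : ∫⁻ p, absSpectrum m U p ^ 2 *
      ENNReal.ofReal ((1 + |modulation p|) ^ (1 + δ)) < ⊤)
    (hVf : ∫⁻ p, absSpectrum m V p ^ 2 *
      ENNReal.ofReal ((1 + |modulation p|) ^ (1 + δ)) < ⊤) (p : ℝ × ℝ) :
    ∫⁻ q, absSpectrum m U q * absSpectrum m V (p - q) < ⊤ := by
  have hle : ∀ W : ℝ × ℝ → ℂ, ∫⁻ p, absSpectrum m W p ^ 2 ≤ ∫⁻ p, absSpectrum m W p ^ 2 *
      ENNReal.ofReal ((1 + |modulation p|) ^ (1 + δ)) := by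
    intro W
    apply lintegral_mono
    intro p
    refine le_mul_of_one_le_right zero_le ?_
    rw [ENNReal.one_le_ofReal]
    exact Real.one_le_rpow (by linarith [abs_nonneg (modulation p)]) (by linarith)
  have hVp : AEMeasurable (fun q => absSpectrum m V (p - q)) :=
    (hm.aemeasurable_absSpectrum hV).comp_quasiMeasurePreserving
      (Measure.measurePreserving_sub_left volume p).quasiMeasurePreserving
  have h := sq_lintegral_mul_le (hm.aemeasurable_absSpectrum hU) hVp
  rw [lintegral_sub_left_eq_self (fun q => absSpectrum m V q ^ 2) p] at h
  have h2 : (∫⁻ q, absSpectrum m U q * absSpectrum m V (p - q)) ^ 2 < ⊤ :=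
    h.trans_lt (ENNReal.mul_lt_top ((hle U).trans_lt hUf) ((hle V).trans_lt hVf))
  by_contra htop
  rw [not_lt, top_le_iff] at htop
  simp [htop] at h2

lemma ae_snd_ne_zero : ∀ᵐ p : ℝ × ℝ, p.2 ≠ 0 := by
  have h : (volume : Measure ℝ) {0} = 0 := by simp
  have := (Measure.quasiMeasurePreserving_snd (μ := (volume : Measure ℝ))
    (ν := (volume : Measure ℝ))).preimage_null h
  rw [← Measure.volume_eq_prod] at this
  exact measure_eq_zero_iff_ae_notMem.1 this

/-- The weighted bilinear estimate makes the dominating convolution finite almost everywhere. -/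
lemma ae_dominantConv_lt_top (hm : IsSymbol s N m) (hs : -3 / 4 < s) (hs0 : s < 0)
    (hN : 1 ≤ N) (hA : ∀ ξ, |deriv m ξ| ≤ A / N) (hδ : 0 < δ) {U V : ℝ × ℝ → ℂ}
    (hU : AEStronglyMeasurable U) (hV : AEStronglyMeasurable V)
    (hUf : ∫⁻ p, absSpectrum m U p ^ 2 *
      ENNReal.ofReal ((1 + |modulation p|) ^ (1 + δ)) < ⊤)
    (hVf : ∫⁻ p, absSpectrum m V p ^ 2 *
      ENNReal.ofReal ((1 + |modulation p|) ^ (1 + δ)) < ⊤) :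
    ∀ᵐ p, dominantConv m (absSpectrum m U) (absSpectrum m V) p < ⊤ := by
  have hU' := hm.aemeasurable_absSpectrum hU
  have hV' := hm.aemeasurable_absSpectrum hV
  have h := lintegral_sq_dominantConv_le hm hs hs0 hN hA hδ hU' hV'
  have hmeas := measurable_dominantConv hm.smooth.continuous.measurable hU' hV'
  have hfin := ae_lt_top (by fun_prop) (h.trans_lt (by
    have := kernelConst_lt_top hδ
    finiteness)).ne
  filter_upwards [hfin, ae_snd_ne_zero] with p hp hp2
  by_contra htop
  rw [not_lt, top_le_iff] at htop
  have h1 : ENNReal.ofReal |p.2| ≠ 0 := by simpa using hp2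
  have h2 : decayWeight δ (modulation p) ≠ 0 := by
    unfold decayWeight
    rw [ne_eq, ENNReal.ofReal_eq_zero, not_le]
    positivity
  simp [htop, h1, h2] at hp

/-- The unweighted product is controlled by the commutator and the product of the smoothed
functions, since `m(ξ) ≤ |m(ξ₁) m(ξ₂) - m(ξ)| + m(ξ₁) m(ξ₂)`. -/
lemma IsSymbol.mul_enorm_le (hm : IsSymbol s N m) (hs : -3 / 4 < s) (hN : 1 ≤ N)
    (U V : ℝ × ℝ → ℂ) (p q : ℝ × ℝ) :
    ENNReal.ofReal (m p.2) * ‖U q * V (p - q)‖ₑ ≤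
      ENNReal.ofReal (relSymbol m q.2 (p - q).2) *
        (absSpectrum m U q * absSpectrum m V (p - q)) +
      absSpectrum m U q * absSpectrum m V (p - q) := by
  have hx := hm.pos hs hN q.2
  have hy := hm.pos hs hN (p - q).2
  have hM := hm.relSymbol_nonneg hs hN q.2 (p - q).2
  unfold absSpectrum multiplierSpectrum
  rw [enorm_ofReal_mul hx.le, enorm_ofReal_mul hy.le, enorm_mul,
    mul_mul_mul_comm (ENNReal.ofReal (m q.2)), ← ENNReal.ofReal_mul hx.le,
    ← mul_assoc (ENNReal.ofReal (relSymbol m q.2 (p - q).2)), ← ENNReal.ofReal_mul hM, ← add_mul, ← ENNReal.ofReal_add (by positivity) (by positivity)]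
  gcongr
  have h1 : relSymbol m q.2 (p - q).2 * (m q.2 * m (p - q).2) =
      |m q.2 * m (p - q).2 - m p.2| := by
    unfold relSymbol
    rw [div_mul_cancel₀ _ (mul_pos hx hy).ne']
    simp
  rw [h1]
  linarith [neg_abs_le (m q.2 * m (p - q).2 - m p.2)]

/-- Both convolution integrals converge absolutely almost everywhere. -/
theorem ae_integrable_convolution (hm : IsSymbol s N m) (hs : -3 / 4 < s) (hs0 : s < 0)
    (hN : 1 ≤ N) (hA : ∀ ξ, |deriv m ξ| ≤ A / N) (hδ : 0 < δ) {U V : ℝ × ℝ → ℂ}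
    (hU : AEStronglyMeasurable U) (hV : AEStronglyMeasurable V)
    (hUf : ∫⁻ p, absSpectrum m U p ^ 2 *
      ENNReal.ofReal ((1 + |modulation p|) ^ (1 + δ)) < ⊤)
    (hVf : ∫⁻ p, absSpectrum m V p ^ 2 *
      ENNReal.ofReal ((1 + |modulation p|) ^ (1 + δ)) < ⊤) :
    ∀ᵐ p : ℝ × ℝ,
      Integrable (fun q => multiplierSpectrum m U q * multiplierSpectrum m V (p - q)) ∧
      Integrable (fun q => U q * V (p - q)) := by
  filter_upwards [ae_dominantConv_lt_top hm hs hs0 hN hA hδ hU hV hUf hVf] with p hp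
  have h1 := lintegral_absSpectrum_mul_lt_top hm hδ hU hV hUf hVf p
  constructor
  · refine ⟨(hm.aestronglyMeasurable_multiplierSpectrum hU).mul
      (aestronglyMeasurable_comp_sub_left (hm.aestronglyMeasurable_multiplierSpectrum hV) p), ?_⟩
    rw [hasFiniteIntegral_iff_enorm]
    simpa only [enorm_mul, absSpectrum] using h1
  · refine ⟨hU.mul (aestronglyMeasurable_comp_sub_left hV p), ?_⟩
    rw [hasFiniteIntegral_iff_enorm]
    have h2 := lintegral_mono (μ := volume) (hm.mul_enorm_le hs hN U V p)
    have hVp : AEMeasurable (fun q => absSpectrum m V (p - q)) :=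
      (hm.aemeasurable_absSpectrum hV).comp_quasiMeasurePreserving
        (Measure.measurePreserving_sub_left volume p).quasiMeasurePreserving
    have hUV : AEMeasurable (fun q => absSpectrum m U q * absSpectrum m V (p - q)) :=
      (hm.aemeasurable_absSpectrum hU).mul hVp
    rw [lintegral_const_mul' _ _ ENNReal.ofReal_ne_top, lintegral_add_right' _ hUV] at h2
    have h3 := h2.trans_lt (ENNReal.add_lt_top.2 ⟨hp, h1⟩)
    have h4 : ENNReal.ofReal (m p.2) ≠ 0 := by simpa using hm.pos hs hN p.2
    by_contra htop
    rw [not_lt, top_le_iff] at htop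
    rw [htop, ENNReal.mul_top h4] at h3
    exact lt_irrefl _ h3

/-- Where the convolutions converge, the transform of the commutator is dominated by the bilinear
operator with the relative symbol. -/
lemma enorm_commutatorSpectrum_le (hm : IsSymbol s N m) (hs : -3 / 4 < s)
    (hN : 1 ≤ N) {U V : ℝ × ℝ → ℂ} {p : ℝ × ℝ}
    (h1 : Integrable (fun q => multiplierSpectrum m U q * multiplierSpectrum m V (p - q)))
    (h2 : Integrable (fun q => U q * V (p - q))) :
    ‖commutatorSpectrum m U V p‖ₑ ≤
      ENNReal.ofReal |p.2| * dominantConv m (absSpectrum m U) (absSpectrum m V) p := by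
  set c : ℂ := 1 / (2 * (Real.pi : ℂ)) ^ 2 with hc
  have hc1 : ‖c‖ₑ ≤ 1 := by
    rw [← ofReal_norm, ENNReal.ofReal_le_one, hc, norm_div, norm_one, norm_pow, norm_mul,
      Complex.norm_real, Real.norm_of_nonneg Real.pi_pos.le, Complex.norm_ofNat]
    rw [div_le_one (by positivity)]
    nlinarith [Real.pi_gt_three]
  have heq : commutatorSpectrum m U V p = Complex.I * ((p.2 : ℂ) * (c *
      ∫ q, (multiplierSpectrum m U q * multiplierSpectrum m V (p - q) -
        (m p.2 : ℂ) * (U q * V (p - q))))) := by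
    rw [integral_sub h1 (h2.const_mul _), integral_const_mul]
    unfold commutatorSpectrum productSpectrum
    rw [multiplierSpectrum]
    ring
  rw [heq, enorm_mul, enorm_mul, enorm_mul]
  have hI : ‖Complex.I‖ₑ = 1 := by rw [← ofReal_norm, Complex.norm_I, ENNReal.ofReal_one]
  have hp : ‖(p.2 : ℂ)‖ₑ = ENNReal.ofReal |p.2| := by
    rw [← ofReal_norm, Complex.norm_real, Real.norm_eq_abs]
  rw [hI, hp, one_mul]
  gcongr
  refine (mul_le_of_le_one_left zero_le hc1).trans ?_
  refine (enorm_integral_le_lintegral_enorm _).trans (lintegral_mono fun q => ?_)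
  have hx := hm.pos hs hN q.2
  have hy := hm.pos hs hN (p - q).2
  have hM := hm.relSymbol_nonneg hs hN q.2 (p - q).2
  apply le_of_eq
  have h3 : multiplierSpectrum m U q * multiplierSpectrum m V (p - q) -
      (m p.2 : ℂ) * (U q * V (p - q)) =
      ((m q.2 * m (p - q).2 - m p.2 : ℝ) : ℂ) * (U q * V (p - q)) := by
    unfold multiplierSpectrum; push_cast; ring
  have h4 : |m q.2 * m (p - q).2 - m p.2| =
      relSymbol m q.2 (p - q).2 * (m q.2 * m (p - q).2) := by
    unfold relSymbol
    rw [div_mul_cancel₀ _ (mul_pos hx hy).ne']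
    simp
  rw [h3, enorm_mul, ← ofReal_norm ((_ : ℝ) : ℂ), Complex.norm_real, Real.norm_eq_abs, h4]
  unfold absSpectrum multiplierSpectrum
  rw [enorm_ofReal_mul hx.le, enorm_ofReal_mul hy.le, enorm_mul,
    mul_mul_mul_comm (ENNReal.ofReal (m q.2)), ← ENNReal.ofReal_mul hx.le,
    ← mul_assoc (ENNReal.ofReal (relSymbol m q.2 (p - q).2)), ← ENNReal.ofReal_mul hM]

/-- The commutator estimate for transforms, with a constant that depends only on the bound for `m'`
and the gap `δ` of the modulation exponents. -/
theorem exists_spectralNorm_commutatorSpectrum_le (A : ℝ) (hs : -3 / 4 < s) (hs0 : s < 0)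
    {b b' : ℝ} (hδ : 0 < δ) (hb : 1 + δ ≤ 2 * b) (hb' : 2 * b' ≤ -(1 + δ)) :
    ∃ C : ℝ, 0 < C ∧ ∀ (N : ℝ) (m : ℝ → ℝ), 1 ≤ N → IsSymbol s N m →
      (∀ ξ, |deriv m ξ| ≤ A / N) → ∀ U V : ℝ × ℝ → ℂ, AEStronglyMeasurable U →
      AEStronglyMeasurable V → spectralNorm 0 b (multiplierSpectrum m U) < ⊤ →
      spectralNorm 0 b (multiplierSpectrum m V) < ⊤ →
      (∀ᵐ p : ℝ × ℝ,
        Integrable (fun q => multiplierSpectrum m U q * multiplierSpectrum m V (p - q)) ∧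
        Integrable (fun q => U q * V (p - q))) ∧
      spectralNorm 0 b' (commutatorSpectrum m U V) ≤
        ENNReal.ofReal (C * N ^ (-3 / 4 : ℝ)) * spectralNorm 0 b (multiplierSpectrum m U) *
          spectralNorm 0 b (multiplierSpectrum m V) := by
  -- The square of the constant; `symbolConst A N` is `symbolConst A 1` times `N^{-3/2}`.
  set K : ℝ := 9 * (symbolConst A 1 * (kernelConst δ).toReal) with hK
  have hK0 : 0 ≤ K := by
    have := symbolConst_nonneg (A := A) le_rfl
    positivity
  refine ⟨√K + 1, by positivity, fun N m hN hm hA U V hU hV hUf hVf => ?_⟩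
  have hle : ∀ W : ℝ × ℝ → ℂ, ∫⁻ p, absSpectrum m W p ^ 2 *
      ENNReal.ofReal ((1 + |modulation p|) ^ (1 + δ)) ≤
        spectralNorm 0 b (multiplierSpectrum m W) ^ 2 := fun W =>
    lintegral_sq_mul_le_spectralNorm hb _
  have hint := ae_integrable_convolution hm hs hs0 hN hA hδ hU hV
    ((hle U).trans_lt (ENNReal.pow_lt_top hUf)) ((hle V).trans_lt (ENNReal.pow_lt_top hVf))
  refine ⟨hint, ?_⟩
  rw [← ENNReal.pow_le_pow_left_iff two_ne_zero]
  calc _ ≤ ∫⁻ p, ‖commutatorSpectrum m U V p‖ₑ ^ 2 * decayWeight δ (modulation p) :=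
        spectralNorm_sq_le_lintegral hb' _
    _ ≤ ∫⁻ p, (ENNReal.ofReal |p.2| *
          dominantConv m (absSpectrum m U) (absSpectrum m V) p) ^ 2 *
            decayWeight δ (modulation p) := by
        apply lintegral_mono_ae
        filter_upwards [hint] with p hp
        gcongr
        exact enorm_commutatorSpectrum_le hm hs hN hp.1 hp.2
    _ ≤ _ := lintegral_sq_dominantConv_le hm hs hs0 hN hA hδ (hm.aemeasurable_absSpectrum hU)
        (hm.aemeasurable_absSpectrum hV)
    _ ≤ 9 * (ENNReal.ofReal (symbolConst A N) * kernelConst δ *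
          (spectralNorm 0 b (multiplierSpectrum m U) ^ 2 *
            spectralNorm 0 b (multiplierSpectrum m V) ^ 2)) := by
        gcongr
        · exact hle U
        · exact hle V
    _ = ENNReal.ofReal (K * N ^ (-3 / 2 : ℝ)) *
          (spectralNorm 0 b (multiplierSpectrum m U) ^ 2 *
            spectralNorm 0 b (multiplierSpectrum m V) ^ 2) := by
        have h1 : symbolConst A N = symbolConst A 1 * N ^ (-3 / 2 : ℝ) := by
          unfold symbolConst; rw [Real.one_rpow]; ring
        have h2 : K * N ^ (-3 / 2 : ℝ) = 9 * (symbolConst A N * (kernelConst δ).toReal) := by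
          rw [h1, hK]; ring
        rw [h2, ENNReal.ofReal_mul (by norm_num), ENNReal.ofReal_mul (symbolConst_nonneg hN),
          ENNReal.ofReal_toReal (kernelConst_lt_top hδ).ne, ENNReal.ofReal_ofNat]
        ring
    _ ≤ ENNReal.ofReal (((√K + 1) * N ^ (-3 / 4 : ℝ)) ^ 2) *
          (spectralNorm 0 b (multiplierSpectrum m U) ^ 2 *
            spectralNorm 0 b (multiplierSpectrum m V) ^ 2) := by
        gcongr
        rw [mul_pow, ← Real.rpow_mul_natCast (by linarith)]
        norm_num
        gcongr
        nlinarith [Real.sq_sqrt hK0, Real.sqrt_nonneg K]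
    _ = _ := by
        rw [ENNReal.ofReal_pow (by positivity)]
        ring

end Estimate

/-! ### Temperate growth of the symbol -/

/-- The derivatives of a smooth function with a power profile at `+∞` are bounded there. -/
lemma norm_iteratedDeriv_le_of_eq_rpow {f : ℝ → ℝ} {c s R : ℝ} (hs0 : s < 0) (hR : 1 ≤ R)
    (hf : ∀ x, R ≤ x → f x = c * x ^ s) (n : ℕ) {x : ℝ} (hx : R < x) :
    ‖iteratedDeriv n f x‖ ≤ |c * (descPochhammer ℝ n).eval s| := by
  have hev : f =ᶠ[nhds x] fun y => c * y ^ s := by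
    filter_upwards [lt_mem_nhds hx] with y hy using hf y hy.le
  rw [hev.iteratedDeriv_eq, iteratedDeriv_const_mul_field, iteratedDeriv_eq_iterate,
    Real.iter_deriv_rpow_const, ← mul_assoc, norm_mul, Real.norm_eq_abs, Real.norm_eq_abs]
  refine mul_le_of_le_one_right (abs_nonneg _) ?_
  have hx0 : 0 < x := by linarith
  rw [abs_of_pos (by positivity)]
  exact Real.rpow_le_one_of_one_le_of_nonpos (by linarith)
    (by linarith [(Nat.cast_nonneg n : (0 : ℝ) ≤ n)])

lemma IsSymbol.hasTemperateGrowth {s N : ℝ} {m : ℝ → ℝ} (hm : IsSymbol s N m) (hs0 : s < 0)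
    (hN : 1 ≤ N) : m.HasTemperateGrowth := by
  refine ⟨hm.smooth, fun n => ?_⟩
  have hcont : Continuous (iteratedDeriv n m) :=
    hm.smooth.continuous_iteratedDeriv n (by exact_mod_cast le_top)
  obtain ⟨C, hC⟩ := (isCompact_Icc (a := -(10 * N)) (b := 10 * N)).exists_bound_of_continuousOn
    hcont.continuousOn
  set c := |N ^ (-s) * (descPochhammer ℝ n).eval s| with hc
  have hbound : ∀ f : ℝ → ℝ, (∀ x, 10 * N ≤ |x| → f x = N ^ (-s) * |x| ^ s) →
      ∀ x, 10 * N < x → ‖iteratedDeriv n f x‖ ≤ c := fun f hf x hx =>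
    norm_iteratedDeriv_le_of_eq_rpow hs0 (by linarith) (fun y hy => by
      have hy' : |y| = y := abs_of_nonneg (by linarith)
      rw [hf y (by rwa [hy']), hy']) n hx
  refine ⟨0, max C c, fun x => ?_⟩
  rw [norm_iteratedFDeriv_eq_norm_iteratedDeriv, pow_zero, mul_one]
  by_cases hx : x ∈ Set.Icc (-(10 * N)) (10 * N)
  · exact (hC x hx).trans (le_max_left _ _)
  · refine le_trans ?_ (le_max_right _ _)
    rcases lt_or_ge (10 * N) x with h | h
    · exact hbound m hm.high x h
    · have hx' : 10 * N < -x := by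
        by_contra h'
        exact hx ⟨by linarith, h⟩
      have h2 := hbound (fun y => m (-y)) (fun y hy => by
        rw [hm.high (-y) (by rwa [abs_neg]), abs_neg]) (-x) hx'
      rwa [iteratedDeriv_comp_neg, neg_neg, norm_smul, norm_pow, norm_neg, norm_one, one_pow,
        one_mul] at h2

lemma IsSymbol.hasTemperateGrowth_snd {s N : ℝ} {m : ℝ → ℝ} (hm : IsSymbol s N m) (hs0 : s < 0)
    (hN : 1 ≤ N) : (fun p : ℝ × ℝ => (m p.2 : ℂ)).HasTemperateGrowth :=
  Function.Complex.hasTemperateGrowth_ofReal.comp ((hm.hasTemperateGrowth hs0 hN).comp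
    (ContinuousLinearMap.snd ℝ ℝ ℝ).hasTemperateGrowth)

/-! ### The spacetime Fourier transform on Schwartz functions -/

section Fourier

open scoped FourierTransform LineDeriv

/-- The character `e^{-i (x ξ + t τ)}` at `q = (t, x)`, `p = (τ, ξ)`. -/
noncomputable def spacetimeChar (q p : ℝ × ℝ) : ℂ :=
  Complex.exp (-(Complex.I * ((q.2 : ℂ) * (p.2 : ℂ) + (q.1 : ℂ) * (p.1 : ℂ))))

lemma spacetimeFourier_eq (u : ℝ × ℝ → ℂ) (p : ℝ × ℝ) :
    spacetimeFourier u p = ∫ q, spacetimeChar q p * u q := rfl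

lemma spacetimeChar_comm (q p : ℝ × ℝ) : spacetimeChar q p = spacetimeChar p q := by
  unfold spacetimeChar; congr 2; ring

lemma spacetimeChar_neg (q p : ℝ × ℝ) : spacetimeChar (-q) p = spacetimeChar q (-p) := by
  unfold spacetimeChar; simp

lemma spacetimeChar_add (q p p' : ℝ × ℝ) :
    spacetimeChar q (p + p') = spacetimeChar q p * spacetimeChar q p' := by
  unfold spacetimeChar; rw [← Complex.exp_add]; congr 1; push_cast [Prod.fst_add, Prod.snd_add]
  ring

lemma norm_spacetimeChar (q p : ℝ × ℝ) : ‖spacetimeChar q p‖ = 1 := by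
  have : -(Complex.I * ((q.2 : ℂ) * (p.2 : ℂ) + (q.1 : ℂ) * (p.1 : ℂ))) =
      ((-(q.2 * p.2 + q.1 * p.1) : ℝ) : ℂ) * Complex.I := by push_cast; ring
  rw [spacetimeChar, this, Complex.norm_exp_ofReal_mul_I]

@[fun_prop]
lemma continuous_spacetimeChar :
    Continuous (fun z : (ℝ × ℝ) × (ℝ × ℝ) => spacetimeChar z.1 z.2) := by
  unfold spacetimeChar; fun_prop

lemma integrable_spacetimeChar_mul {u : ℝ × ℝ → ℂ} (hu : Integrable u) (p : ℝ × ℝ) :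
    Integrable (fun q => spacetimeChar q p * u q) := by
  have hc : Continuous (fun q => spacetimeChar q p) :=
    continuous_spacetimeChar.comp (Continuous.prodMk_left p)
  exact hu.bdd_mul hc.aestronglyMeasurable
    (Filter.Eventually.of_forall fun q => (norm_spacetimeChar q p).le)

/-- The Euclidean plane, on which the Fourier transform of Schwartz functions is available, with
its coordinates. -/
noncomputable abbrev planeEquiv : WithLp 2 (ℝ × ℝ) ≃L[ℝ] ℝ × ℝ :=
  WithLp.prodContinuousLinearEquiv 2 ℝ ℝ ℝ

lemma fourier_comp_planeEquiv (u : ℝ × ℝ → ℂ) (w : WithLp 2 (ℝ × ℝ)) :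
    𝓕 (u ∘ planeEquiv) w = spacetimeFourier u ((2 * Real.pi) • planeEquiv w) := by
  rw [Real.fourier_eq', spacetimeFourier_eq]
  have h := (WithLp.volume_preserving_ofLp ℝ ℝ).integral_comp
    (MeasurableEquiv.toLp 2 (ℝ × ℝ)).symm.measurableEmbedding
    (fun q => spacetimeChar q ((2 * Real.pi) • planeEquiv w) * u q)
  rw [← h]
  congr 1 with v
  rw [smul_eq_mul]
  congr 1
  unfold spacetimeChar
  congr 1
  rw [WithLp.prod_inner_apply]
  simp
  ring

/-- The dilation relating the two normalizations of the Fourier transform. -/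
noncomputable def planeScale : (ℝ × ℝ) ≃L[ℝ] WithLp 2 (ℝ × ℝ) :=
  (ContinuousLinearEquiv.smulLeft (Units.mk0 ((2 * Real.pi)⁻¹ : ℝ)
    (inv_ne_zero Real.two_pi_pos.ne'))).trans planeEquiv.symm

lemma planeEquiv_planeScale (p : ℝ × ℝ) :
    planeEquiv (planeScale p) = (2 * Real.pi)⁻¹ • p :=
  planeEquiv.apply_symm_apply _

/-- The spacetime Fourier transform as a map of Schwartz functions. -/
noncomputable def schwartzFourier (u : 𝓢(ℝ × ℝ, ℂ)) : 𝓢(ℝ × ℝ, ℂ) :=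
  SchwartzMap.compCLMOfContinuousLinearEquiv ℂ planeScale
    (𝓕 (SchwartzMap.compCLMOfContinuousLinearEquiv ℂ planeEquiv u))

lemma schwartzFourier_eq_fourier (u : 𝓢(ℝ × ℝ, ℂ)) (p : ℝ × ℝ) :
    schwartzFourier u p =
      𝓕 (SchwartzMap.compCLMOfContinuousLinearEquiv ℂ planeEquiv u) (planeScale p) := rfl

lemma schwartzFourier_apply (u : 𝓢(ℝ × ℝ, ℂ)) (p : ℝ × ℝ) :
    schwartzFourier u p = spacetimeFourier u p := by
  rw [schwartzFourier_eq_fourier, SchwartzMap.fourier_coe,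
    SchwartzMap.compCLMOfContinuousLinearEquiv_apply, fourier_comp_planeEquiv,
    planeEquiv_planeScale, smul_inv_smul₀ Real.two_pi_pos.ne']

lemma spacetimeFourier_comp_neg (u : ℝ × ℝ → ℂ) (p : ℝ × ℝ) :
    spacetimeFourier (fun q => u (-q)) p = spacetimeFourier u (-p) := by
  rw [spacetimeFourier_eq, spacetimeFourier_eq, ← integral_neg_eq_self]
  simp_rw [spacetimeChar_neg, neg_neg]

/-- Fourier inversion. -/
lemma schwartzFourier_schwartzFourier (g : 𝓢(ℝ × ℝ, ℂ)) (q : ℝ × ℝ) :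
    schwartzFourier (schwartzFourier g) q = (2 * (Real.pi : ℂ)) ^ 2 * g (-q) := by
  set G := SchwartzMap.compCLMOfContinuousLinearEquiv ℂ planeEquiv g with hG
  have h1 : ∀ p : ℝ × ℝ, (2 * Real.pi) • planeEquiv (planeEquiv.symm p) = (2 * Real.pi) • p := by
    simp
  have h2 : spacetimeFourier (fun p => 𝓕 G (planeEquiv.symm p)) ((2 * Real.pi) • q) = g (-q) := by
    rw [← h1, ← fourier_comp_planeEquiv]
    have h3 : (fun p => 𝓕 G (planeEquiv.symm p)) ∘ planeEquiv = 𝓕 (G : _ → ℂ) := by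
      ext v; simp [SchwartzMap.fourier_coe]
    rw [h3]
    have h4 := Real.fourierInv_eq_fourier_neg (𝓕 (G : _ → ℂ)) (-planeEquiv.symm q)
    rw [neg_neg, ← SchwartzMap.fourier_coe, ← SchwartzMap.fourierInv_coe] at h4
    rw [← SchwartzMap.fourier_coe, ← h4]
    rw [FourierTransform.fourierInv_fourier_eq, hG]
    simp
  rw [schwartzFourier_apply, ← h2, spacetimeFourier_eq, spacetimeFourier_eq]
  have h5 := Measure.integral_comp_smul (volume : Measure (ℝ × ℝ))
    (fun p => spacetimeChar p q * schwartzFourier g p) (2 * Real.pi)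
  have h6 : ∀ p : ℝ × ℝ, spacetimeChar ((2 * Real.pi) • p) q *
      schwartzFourier g ((2 * Real.pi) • p) =
        spacetimeChar p ((2 * Real.pi) • q) * 𝓕 G (planeEquiv.symm p) := by
    intro p
    congr 1
    · unfold spacetimeChar
      congr 1
      simp
      ring
    · rw [schwartzFourier_eq_fourier, ← hG]
      congr 1
      apply planeEquiv.injective
      rw [planeEquiv_planeScale, inv_smul_smul₀ Real.two_pi_pos.ne']
      simp
  simp_rw [h6] at h5
  rw [h5, abs_of_pos (by positivity), Complex.real_smul]
  have : Module.finrank ℝ (ℝ × ℝ) = 2 := by simp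
  rw [this]
  push_cast
  have hpi : (Real.pi : ℂ) ≠ 0 := Complex.ofReal_ne_zero.2 Real.pi_pos.ne'
  field_simp

/-- The Fourier transform turns `∂ₓ` into multiplication by `i ξ`. -/
lemma spacetimeFourier_dx (g : 𝓢(ℝ × ℝ, ℂ)) (p : ℝ × ℝ) :
    spacetimeFourier (dx g) p = Complex.I * (p.2 : ℂ) * spacetimeFourier g p := by
  set w : WithLp 2 (ℝ × ℝ) := planeEquiv.symm (0, 1) with hw
  have h1 : dx g = (∂_{((0 : ℝ), (1 : ℝ))} g : 𝓢(ℝ × ℝ, ℂ)) := by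
    ext q
    rw [SchwartzMap.lineDerivOp_apply_eq_fderiv, dx]
    have h2 : HasDerivAt (fun x : ℝ => (q.1, x)) ((0 : ℝ), (1 : ℝ)) q.2 :=
      (hasDerivAt_const _ _).prodMk (hasDerivAt_id _)
    exact ((g.hasFDerivAt q).comp_hasDerivAt q.2 h2).deriv
  rw [h1, ← schwartzFourier_apply, ← schwartzFourier_apply, schwartzFourier_eq_fourier,
    schwartzFourier_eq_fourier]
  have h3 := SchwartzMap.lineDerivOp_compCLMOfContinuousLinearEquiv ℂ w planeEquiv g
  rw [hw, ContinuousLinearEquiv.apply_symm_apply] at h3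
  rw [← h3, SchwartzMap.fourier_lineDerivOp_eq, smul_apply,
    SchwartzMap.smulLeftCLM_apply_apply (Function.hasTemperateGrowth_inner_left _)]
  have h4 : inner ℝ (planeScale p) (planeEquiv.symm ((0 : ℝ), (1 : ℝ))) =
      (2 * Real.pi)⁻¹ * p.2 := by
    have := congrArg Prod.snd (planeEquiv_planeScale p)
    rw [WithLp.prod_inner_apply]
    simp at this ⊢
    exact this
  rw [h4, smul_eq_mul, Complex.real_smul]
  push_cast
  have hpi : (Real.pi : ℂ) ≠ 0 := Complex.ofReal_ne_zero.2 Real.pi_pos.ne'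
  field_simp

lemma integral_spacetimeFourier_mul {f h : ℝ × ℝ → ℂ} (hf : Integrable f) (hh : Integrable h) :
    ∫ q, spacetimeFourier f q * h q = ∫ x, f x * spacetimeFourier h x := by
  simp_rw [spacetimeFourier_eq, ← integral_mul_const, ← integral_const_mul]
  have hint : Integrable (Function.uncurry fun q x => spacetimeChar x q * f x * h q)
      ((volume : Measure (ℝ × ℝ)).prod (volume : Measure (ℝ × ℝ))) := by
    have h1 := (hh.mul_prod hf).bdd_mul (f := fun z : (ℝ × ℝ) × (ℝ × ℝ) => spacetimeChar z.2 z.1)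
      (c := 1) (continuous_spacetimeChar.comp continuous_swap).aestronglyMeasurable
      (Filter.Eventually.of_forall fun z => (norm_spacetimeChar _ _).le)
    refine h1.congr (Filter.Eventually.of_forall fun z => ?_)
    simp only [Function.uncurry]
    ring
  rw [integral_integral_swap hint]
  congr 1 with x
  congr 1 with q
  rw [spacetimeChar_comm]
  ring

/-- The Fourier transform of a product. -/
lemma spacetimeFourier_mul (f g : 𝓢(ℝ × ℝ, ℂ)) (p : ℝ × ℝ) :
    spacetimeFourier (fun q => f q * g q) p =
      productSpectrum (spacetimeFourier f) (spacetimeFourier g) p := by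
  have hint : Integrable (fun q => schwartzFourier g (p - q)) :=
    (schwartzFourier g).integrable.comp_sub_left p
  have h1 : ∀ x, spacetimeFourier (fun q => schwartzFourier g (p - q)) x =
      spacetimeChar x p * ((2 * (Real.pi : ℂ)) ^ 2 * g x) := by
    intro x
    rw [spacetimeFourier_eq, ← integral_sub_left_eq_self _ _ p]
    have h2 : ∀ q, spacetimeChar (p - q) x * schwartzFourier g (p - (p - q)) =
        spacetimeChar x p * (spacetimeChar q (-x) * schwartzFourier g q) := by
      intro q
      rw [sub_sub_cancel, spacetimeChar_comm, sub_eq_add_neg, spacetimeChar_add,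
        spacetimeChar_comm q, spacetimeChar_neg, mul_assoc]
    simp_rw [h2]
    rw [integral_const_mul, ← spacetimeFourier_eq, ← schwartzFourier_apply,
      schwartzFourier_schwartzFourier, neg_neg]
  unfold productSpectrum
  simp_rw [← schwartzFourier_apply g]
  rw [integral_spacetimeFourier_mul f.integrable hint]
  simp_rw [h1]
  rw [spacetimeFourier_eq, ← integral_const_mul]
  congr 1 with q
  have hpi : (Real.pi : ℂ) ≠ 0 := Complex.ofReal_ne_zero.2 Real.pi_pos.ne'
  field_simp

/-- The Schwartz function with a given spacetime Fourier transform. -/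
noncomputable def schwartzSynthesis (G : 𝓢(ℝ × ℝ, ℂ)) : 𝓢(ℝ × ℝ, ℂ) :=
  (1 / (2 * (Real.pi : ℂ)) ^ 2) •
    SchwartzMap.compCLMOfContinuousLinearEquiv ℂ (ContinuousLinearEquiv.neg ℝ) (schwartzFourier G)

lemma schwartzSynthesis_apply (G : 𝓢(ℝ × ℝ, ℂ)) (q : ℝ × ℝ) :
    schwartzSynthesis G q = 1 / (2 * (Real.pi : ℂ)) ^ 2 * spacetimeFourier G (-q) := by
  rw [← schwartzFourier_apply]; rfl

lemma spacetimeFourier_schwartzSynthesis (G : 𝓢(ℝ × ℝ, ℂ)) :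
    spacetimeFourier (schwartzSynthesis G) = G := by
  ext p
  have h1 : (schwartzSynthesis G : ℝ × ℝ → ℂ) = fun q =>
      1 / (2 * (Real.pi : ℂ)) ^ 2 * (fun q => schwartzFourier G (-q)) q := by
    ext q
    simp only [schwartzSynthesis_apply, schwartzFourier_apply]
  have h2 : spacetimeFourier (schwartzSynthesis G) p =
      1 / (2 * (Real.pi : ℂ)) ^ 2 * spacetimeFourier (fun q => schwartzFourier G (-q)) p := by
    rw [h1, spacetimeFourier_eq, spacetimeFourier_eq, ← integral_const_mul]
    congr 1 with q
    ring
  have hpi : (Real.pi : ℂ) ≠ 0 := Complex.ofReal_ne_zero.2 Real.pi_pos.ne'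
  rw [h2, spacetimeFourier_comp_neg, ← schwartzFourier_apply, schwartzFourier_schwartzFourier,
    neg_neg]
  field_simp

end Fourier

/-! ### The multiplier operator on Schwartz functions -/

section Multiplier

open scoped FourierTransform

lemma exists_norm_le_decay (F : 𝓢(ℝ × ℝ, ℂ)) :
    ∃ C : ℝ, ∀ p : ℝ × ℝ, ‖F p‖ ≤ C * (1 + ‖p.1‖) ^ (-2 : ℝ) ∧
      ‖F p‖ ≤ C * (1 + ‖p.2‖) ^ (-2 : ℝ) := by
  set C := 2 ^ 2 * ((Finset.Iic (2, 0)).sup (schwartzSeminormFamily ℝ (ℝ × ℝ) ℂ)) F with hC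
  have h : ∀ p : ℝ × ℝ, (1 + ‖p‖) ^ 2 * ‖F p‖ ≤ C := by
    intro p
    have := SchwartzMap.one_add_le_sup_seminorm_apply (𝕜 := ℝ) (m := (2, 0)) (k := 2) (n := 0)
      le_rfl le_rfl F p
    rwa [norm_iteratedFDeriv_zero] at this
  have key : ∀ (p : ℝ × ℝ) (r : ℝ), 0 ≤ r → r ≤ ‖p‖ → ‖F p‖ ≤ C * (1 + r) ^ (-2 : ℝ) := by
    intro p r hr hrp
    rw [Real.rpow_neg (by positivity), ← div_eq_mul_inv, le_div_iff₀ (by positivity), mul_comm]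
    refine le_trans ?_ (h p)
    gcongr
    rw [← Real.rpow_natCast]
    norm_num
    gcongr
  exact ⟨C, fun p => ⟨key p _ (norm_nonneg _) (norm_fst_le p),
    key p _ (norm_nonneg _) (norm_snd_le p)⟩⟩

lemma integrable_one_add_norm_rpow_neg_two :
    Integrable (fun x : ℝ => (1 + ‖x‖) ^ (-2 : ℝ)) :=
  integrable_one_add_norm (by simp)

lemma integrable_fst_slice (F : 𝓢(ℝ × ℝ, ℂ)) (ξ : ℝ) : Integrable (fun τ => F (τ, ξ)) := by
  obtain ⟨C, hC⟩ := exists_norm_le_decay F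
  refine (integrable_one_add_norm_rpow_neg_two.const_mul C).mono' ?_
    (Filter.Eventually.of_forall fun τ => (hC (τ, ξ)).1)
  have : Continuous (fun τ => F (τ, ξ)) := by fun_prop
  exact this.aestronglyMeasurable

lemma continuous_spatialFourier_slice (u : 𝓢(ℝ × ℝ, ℂ)) (ξ : ℝ) :
    Continuous (fun t => spatialFourier (fun x => u (t, x)) ξ) := by
  obtain ⟨C, hC⟩ := exists_norm_le_decay u
  unfold spatialFourier
  refine continuous_of_dominated (bound := fun x => C * (1 + ‖x‖) ^ (-2 : ℝ)) (fun t => ?_)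
    (fun t => Filter.Eventually.of_forall fun x => ?_)
    (integrable_one_add_norm_rpow_neg_two.const_mul C)
    (Filter.Eventually.of_forall fun x => ?_)
  · have : Continuous (fun x : ℝ =>
        Complex.exp (-(Complex.I * ((x : ℂ) * (ξ : ℂ)))) * u (t, x)) := by fun_prop
    exact this.aestronglyMeasurable
  · have h1 : -(Complex.I * ((x : ℂ) * (ξ : ℂ))) = ((-(x * ξ) : ℝ) : ℂ) * Complex.I := by
      push_cast; ring
    rw [norm_mul, h1, Complex.norm_exp_ofReal_mul_I, one_mul]
    exact (hC (t, x)).2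
  · fun_prop

/-- Inversion in the time variable alone, at a fixed spatial frequency. -/
lemma spatialFourier_slice_eq (u : 𝓢(ℝ × ℝ, ℂ)) (t ξ : ℝ) :
    spatialFourier (fun x => u (t, x)) ξ =
      1 / (2 * (Real.pi : ℂ)) * ∫ τ : ℝ, Complex.exp (Complex.I * ((t : ℂ) * (τ : ℂ))) *
        spacetimeFourier u (τ, ξ) := by
  set g : ℝ → ℂ := fun t => spatialFourier (fun x => u (t, x)) ξ with hg
  have hH : Integrable (fun q : ℝ × ℝ => spacetimeChar q (0, ξ) * u q)
      ((volume : Measure ℝ).prod volume) := integrable_spacetimeChar_mul u.integrable _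
  have hgint : Integrable g := by
    refine hH.integral_prod_left.congr (Filter.Eventually.of_forall fun t => ?_)
    simp [hg, spatialFourier, spacetimeChar]
  have hgF : ∀ w, 𝓕 g w = spacetimeFourier u (2 * Real.pi * w, ξ) := by
    intro w
    rw [Real.fourier_real_eq_integral_exp_smul, spacetimeFourier_eq, Measure.volume_eq_prod,
      integral_prod _ (integrable_spacetimeChar_mul u.integrable _)]
    congr 1 with t
    rw [hg, smul_eq_mul]
    simp only [spatialFourier]
    rw [← integral_const_mul]
    congr 1 with x
    rw [← mul_assoc, ← Complex.exp_add, spacetimeChar]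
    congr 2
    push_cast
    ring
  have hslice : Integrable (fun τ => spacetimeFourier u (τ, ξ)) := by
    simpa only [schwartzFourier_apply] using integrable_fst_slice (schwartzFourier u) ξ
  have hFint : Integrable (𝓕 g) := by
    rw [show 𝓕 g = fun w => spacetimeFourier u (2 * Real.pi * w, ξ) from funext hgF]
    exact hslice.comp_mul_left' Real.two_pi_pos.ne'
  have hinv := (continuous_spatialFourier_slice u ξ).fourierInv_fourier_eq hgint hFint
  have h1 : g t = 𝓕⁻ (𝓕 g) t := by rw [hinv]
  change g t = _
  rw [h1, Real.fourierInv_eq']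
  have h2 := Measure.integral_comp_mul_left (fun τ : ℝ =>
    Complex.exp (Complex.I * ((t : ℂ) * (τ : ℂ))) * spacetimeFourier u (τ, ξ)) (2 * Real.pi)
  rw [abs_of_pos (by positivity), Complex.real_smul] at h2
  rw [one_div]
  push_cast at h2
  rw [mul_inv, ← mul_inv, ← h2]
  congr 1 with w
  rw [hgF, smul_eq_mul]
  congr 2
  simp
  ring

/-- The multiplier operator, defined slice by slice in time, acts on the spacetime Fourier
transform as multiplication by `m(ξ)`. -/
lemma multiplierOp_eq_schwartzSynthesis {m : ℝ → ℝ}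
    (hm : (fun p : ℝ × ℝ => (m p.2 : ℂ)).HasTemperateGrowth) (u : 𝓢(ℝ × ℝ, ℂ)) :
    multiplierOp m u = schwartzSynthesis (SchwartzMap.smulLeftCLM ℂ
      (fun p : ℝ × ℝ => (m p.2 : ℂ)) (schwartzFourier u)) := by
  ext q
  set G := SchwartzMap.smulLeftCLM ℂ (fun p : ℝ × ℝ => (m p.2 : ℂ)) (schwartzFourier u) with hG
  have hGa : ∀ p, G p = m p.2 * spacetimeFourier u p := by
    intro p
    rw [hG, SchwartzMap.smulLeftCLM_apply_apply hm, schwartzFourier_apply, smul_eq_mul]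
  rw [schwartzSynthesis_apply, spacetimeFourier_eq, Measure.volume_eq_prod,
    integral_prod_symm _ (integrable_spacetimeChar_mul G.integrable _), multiplierOp]
  rw [show 1 / (2 * (Real.pi : ℂ)) ^ 2 = 1 / (2 * (Real.pi : ℂ)) * (1 / (2 * (Real.pi : ℂ))) by
    ring, mul_assoc]
  congr 1
  rw [← integral_const_mul]
  congr 1 with ξ
  rw [spatialFourier_slice_eq, mul_left_comm (m ξ : ℂ), mul_left_comm, ← integral_const_mul,
    ← integral_const_mul]
  congr 2 with τ
  have hchar : spacetimeChar (τ, ξ) (-q) = Complex.exp (Complex.I * ((q.2 : ℂ) * (ξ : ℂ))) *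
      Complex.exp (Complex.I * ((q.1 : ℂ) * (τ : ℂ))) := by
    rw [← Complex.exp_add, spacetimeChar]
    congr 1
    simp
    ring
  rw [hGa, spacetimeChar_comm, ← spacetimeChar_comm (τ, ξ), hchar]
  ring

end Multiplier

/-! ### The commutator of Schwartz functions -/

section Schwartz

variable {s N : ℝ} {m : ℝ → ℝ}

lemma spacetimeFourier_multiplierOp (hm : (fun p : ℝ × ℝ => (m p.2 : ℂ)).HasTemperateGrowth)
    (u : 𝓢(ℝ × ℝ, ℂ)) :
    spacetimeFourier (multiplierOp m u) = multiplierSpectrum m (spacetimeFourier u) := by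
  rw [multiplierOp_eq_schwartzSynthesis hm, spacetimeFourier_schwartzSynthesis]
  ext p
  rw [SchwartzMap.smulLeftCLM_apply_apply hm, schwartzFourier_apply, smul_eq_mul,
    multiplierSpectrum]

/-- Since `I u`, `I v` and `I (u v)` are Schwartz functions, the transform of the commutator is
computed by the product rule and the derivative rule of the Fourier transform. -/
lemma spacetimeFourier_commutator (hm : (fun p : ℝ × ℝ => (m p.2 : ℂ)).HasTemperateGrowth)
    (u v : 𝓢(ℝ × ℝ, ℂ)) :
    spacetimeFourier (commutator m u v) =
      commutatorSpectrum m (spacetimeFourier u) (spacetimeFourier v) := by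
  set mul : 𝓢(ℝ × ℝ, ℂ) → 𝓢(ℝ × ℝ, ℂ) → 𝓢(ℝ × ℝ, ℂ) := fun f g =>
    SchwartzMap.pairing (ContinuousLinearMap.mul ℂ ℂ) f g with hmul
  have hmul_apply : ∀ f g q, mul f g q = f q * g q := fun f g q => rfl
  set J : 𝓢(ℝ × ℝ, ℂ) → 𝓢(ℝ × ℝ, ℂ) := fun f => schwartzSynthesis (SchwartzMap.smulLeftCLM ℂ
    (fun p : ℝ × ℝ => (m p.2 : ℂ)) (schwartzFourier f)) with hJ
  have hJop : ∀ f : 𝓢(ℝ × ℝ, ℂ), multiplierOp m f = J f := fun f =>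
    multiplierOp_eq_schwartzSynthesis hm f
  have hJF : ∀ f : 𝓢(ℝ × ℝ, ℂ),
      spacetimeFourier (J f) = multiplierSpectrum m (spacetimeFourier f) := fun f => by
    rw [← hJop, spacetimeFourier_multiplierOp hm]
  have huv : (fun q => u q * v q) = mul u v := by ext q; rw [hmul_apply]
  have hcomm : commutator m u v = dx (mul (J u) (J v) - J (mul u v) : 𝓢(ℝ × ℝ, ℂ)) := by
    unfold commutator
    rw [huv, hJop u, hJop v, hJop (mul u v)]
    rfl
  ext p
  rw [hcomm, spacetimeFourier_dx, commutatorSpectrum]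
  congr 1
  have hsub : spacetimeFourier (mul (J u) (J v) - J (mul u v) : 𝓢(ℝ × ℝ, ℂ)) p =
      spacetimeFourier (mul (J u) (J v)) p - spacetimeFourier (J (mul u v)) p := by
    simp only [spacetimeFourier_eq]
    rw [← integral_sub (integrable_spacetimeChar_mul (mul (J u) (J v)).integrable p)
      (integrable_spacetimeChar_mul (J (mul u v)).integrable p)]
    congr 1 with q
    rw [sub_apply, mul_sub]
  have h1 : spacetimeFourier (mul (J u) (J v)) p =
      productSpectrum (multiplierSpectrum m (spacetimeFourier u))
        (multiplierSpectrum m (spacetimeFourier v)) p := by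
    rw [← hJF, ← hJF, ← spacetimeFourier_mul]
    rfl
  have h2 : spacetimeFourier (J (mul u v)) p =
      multiplierSpectrum m (productSpectrum (spacetimeFourier u) (spacetimeFourier v)) p := by
    rw [hJF, multiplierSpectrum, multiplierSpectrum, ← spacetimeFourier_mul]
    rfl
  rw [hsub, h1, h2]

/-- Schwartz functions have finite weighted norm, as the weight grows polynomially. -/
lemma spectralNorm_zero_lt_top (b : ℝ) (F : 𝓢(ℝ × ℝ, ℂ)) : spectralNorm 0 b F < ⊤ := by
  obtain ⟨k, hk⟩ := exists_nat_ge b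
  set C := 2 ^ (3 * k + 2) *
    ((Finset.Iic (3 * k + 2, 0)).sup (schwartzSeminormFamily ℝ (ℝ × ℝ) ℂ)) F with hC
  have hdecay : ∀ p : ℝ × ℝ, (1 + ‖p‖) ^ (3 * k + 2) * ‖F p‖ ≤ C := by
    intro p
    have := SchwartzMap.one_add_le_sup_seminorm_apply (𝕜 := ℝ) (m := (3 * k + 2, 0))
      (k := 3 * k + 2) (n := 0) le_rfl le_rfl F p
    rwa [norm_iteratedFDeriv_zero] at this
  have hweight : ∀ p : ℝ × ℝ, (1 + |modulation p|) ^ (2 * b) ≤ ((1 + ‖p‖) ^ (3 * k)) ^ 2 := by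
    intro p
    have h1 : 1 + |modulation p| ≤ (1 + ‖p‖) ^ 3 := by
      have h2 : |p.1| ≤ ‖p‖ := norm_fst_le p
      have h3 : |p.2| ^ 3 ≤ ‖p‖ ^ 3 := by gcongr; exact norm_snd_le p
      have h4 : |modulation p| ≤ |p.1| + |p.2| ^ 3 := by
        rw [← abs_pow]; exact abs_sub _ _
      nlinarith [norm_nonneg p, sq_nonneg ‖p‖]
    calc (1 + |modulation p|) ^ (2 * b) ≤ (1 + |modulation p|) ^ ((2 * k : ℕ) : ℝ) :=
          Real.rpow_le_rpow_of_exponent_le (by linarith [abs_nonneg (modulation p)])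
            (by push_cast; linarith)
      _ = (1 + |modulation p|) ^ (2 * k) := Real.rpow_natCast _ _
      _ ≤ ((1 + ‖p‖) ^ 3) ^ (2 * k) := by gcongr
      _ = _ := by rw [← pow_mul, ← pow_mul]; ring
  have hpt : ∀ p : ℝ × ℝ, ‖F p‖ₑ ^ 2 * ENNReal.ofReal ((1 + |modulation p|) ^ (2 * b)) ≤
      ENNReal.ofReal (C ^ 2) * ENNReal.ofReal ((1 + ‖p‖) ^ (-4 : ℝ)) := by
    intro p
    rw [← ofReal_norm, ← ENNReal.ofReal_pow (norm_nonneg _),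
      ← ENNReal.ofReal_mul (by positivity), ← ENNReal.ofReal_mul (by positivity)]
    apply ENNReal.ofReal_le_ofReal
    rw [Real.rpow_neg (by positivity), ← div_eq_mul_inv, le_div_iff₀ (by positivity)]
    have h4 : (1 + ‖p‖) ^ (4 : ℝ) = ((1 + ‖p‖) ^ 2) ^ 2 := by
      rw [← pow_mul, ← Real.rpow_natCast]; norm_num
    calc _ ≤ ‖F p‖ ^ 2 * ((1 + ‖p‖) ^ (3 * k)) ^ 2 * ((1 + ‖p‖) ^ 2) ^ 2 := by
          rw [h4]; gcongr; exact hweight p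
      _ = ((1 + ‖p‖) ^ (3 * k + 2) * ‖F p‖) ^ 2 := by ring
      _ ≤ C ^ 2 := by gcongr; exact hdecay p
  have hsq : spectralNorm 0 b F ^ 2 < ⊤ := by
    rw [spectralNorm_zero_sq]
    refine (lintegral_mono hpt).trans_lt ?_
    rw [lintegral_const_mul' _ _ ENNReal.ofReal_ne_top]
    exact ENNReal.mul_lt_top ENNReal.ofReal_lt_top
      (finite_integral_one_add_norm (by simp; norm_num))
  by_contra h
  rw [not_lt, top_le_iff] at h
  simp [h] at hsq

end Schwartz

end ExtraSmoothing

theorem mainTheorem4 (s : ℝ) (hs : -3 / 4 < s) (hs0 : s < 0) (A : ℝ)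
    (ε₁ ε₂ ε₃ : ℝ) (hε₁ : 0 < ε₁) (hε₂ : 0 < ε₂) (hε₃ : 0 < ε₃) :
    ∃ C : ℝ, 0 < C ∧ ∀ (N : ℝ) (m : ℝ → ℝ), 1 ≤ N → ExtraSmoothing.IsSymbol s N m →
      (∀ ξ : ℝ, |deriv m ξ| ≤ A / N) →
      (∀ u v : 𝓢(ℝ × ℝ, ℂ),
        ExtraSmoothing.xNorm 0 (-1 / 2 - ε₁) (ExtraSmoothing.commutator m u v) ≤
          ENNReal.ofReal (C * N ^ (-3 / 4 + ε₂)) *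
            ExtraSmoothing.xNorm 0 (1 / 2 + ε₃) (ExtraSmoothing.multiplierOp m u) *
            ExtraSmoothing.xNorm 0 (1 / 2 + ε₃) (ExtraSmoothing.multiplierOp m v)) ∧
      (∀ U V : ℝ × ℝ → ℂ, AEStronglyMeasurable U volume → AEStronglyMeasurable V volume →
        ExtraSmoothing.spectralNorm 0 (1 / 2 + ε₃) (ExtraSmoothing.multiplierSpectrum m U) < ⊤ →
        ExtraSmoothing.spectralNorm 0 (1 / 2 + ε₃) (ExtraSmoothing.multiplierSpectrum m V) < ⊤ →
        (∀ᵐ p : ℝ × ℝ ∂volume,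
          Integrable (fun q : ℝ × ℝ => ExtraSmoothing.multiplierSpectrum m U q *
            ExtraSmoothing.multiplierSpectrum m V (p - q)) volume ∧
          Integrable (fun q : ℝ × ℝ => U q * V (p - q)) volume) ∧
        ExtraSmoothing.spectralNorm 0 (-1 / 2 - ε₁) (ExtraSmoothing.commutatorSpectrum m U V) ≤
          ENNReal.ofReal (C * N ^ (-3 / 4 + ε₂)) *
            ExtraSmoothing.spectralNorm 0 (1 / 2 + ε₃) (ExtraSmoothing.multiplierSpectrum m U) *
            ExtraSmoothing.spectralNorm 0 (1 / 2 + ε₃)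
              (ExtraSmoothing.multiplierSpectrum m V)) := by
  -- All three modulation weights then decay at least like the power `-(1 + δ) / 2`.
  set δ : ℝ := 2 * min ε₁ ε₃ with hδ
  have hδ0 : 0 < δ := by positivity
  have h1 : δ ≤ 2 * ε₁ := by rw [hδ]; gcongr; exact min_le_left _ _
  have h3 : δ ≤ 2 * ε₃ := by rw [hδ]; gcongr; exact min_le_right _ _
  obtain ⟨C, hC, h⟩ := ExtraSmoothing.exists_spectralNorm_commutatorSpectrum_le A hs hs0
    (b := 1 / 2 + ε₃) (b' := -1 / 2 - ε₁) hδ0 (by linarith) (by linarith)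
  refine ⟨C, hC, fun N m hN hm hA => ?_⟩
  -- The estimate holds with the power `-3 / 4`, which is stronger as `N ≥ 1`.
  have hpow : ENNReal.ofReal (C * N ^ (-3 / 4 : ℝ)) ≤
      ENNReal.ofReal (C * N ^ (-3 / 4 + ε₂)) := by
    gcongr
    linarith
  have main := h N m hN hm hA
  constructor
  · intro u v
    have hmt := hm.hasTemperateGrowth_snd hs0 hN
    have hfin : ∀ w : 𝓢(ℝ × ℝ, ℂ), ExtraSmoothing.spectralNorm 0 (1 / 2 + ε₃)
        (ExtraSmoothing.multiplierSpectrum m (ExtraSmoothing.spacetimeFourier w)) < ⊤ := by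
      intro w
      rw [← ExtraSmoothing.spacetimeFourier_multiplierOp hmt,
        ExtraSmoothing.multiplierOp_eq_schwartzSynthesis hmt,
        ExtraSmoothing.spacetimeFourier_schwartzSynthesis]
      exact ExtraSmoothing.spectralNorm_zero_lt_top _ _
    have hmeas : ∀ w : 𝓢(ℝ × ℝ, ℂ),
        AEStronglyMeasurable (ExtraSmoothing.spacetimeFourier w) volume := fun w => by
      rw [← funext (ExtraSmoothing.schwartzFourier_apply w)]
      exact (ExtraSmoothing.schwartzFourier w).continuous.aestronglyMeasurable
    unfold ExtraSmoothing.xNorm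
    rw [ExtraSmoothing.spacetimeFourier_commutator hmt,
      ExtraSmoothing.spacetimeFourier_multiplierOp hmt,
      ExtraSmoothing.spacetimeFourier_multiplierOp hmt]
    refine (main _ _ (hmeas u) (hmeas v) (hfin u) (hfin v)).2.trans ?_
    gcongr
  · intro U V hU hV hUf hVf
    obtain ⟨hint, hle⟩ := main U V hU hV hUf hVf
    refine ⟨hint, hle.trans ?_⟩
    gcongr
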